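/- **Conventions.** A *Boolean $\sigma$-algebra* is a Boolean algebra in which every sequence has a supremum (equivalently, an infimum); a *$\sigma$-homomorphism* is a homomorphism of Boolean algebras that preserves suprema of sequences. Write $\sigma\mathsf{Bool}_\sigma$ for the category of Boolean $\sigma$-algebras and $\sigma$-homomorphisms. All $C^*$-algebras and $*$-homomorphisms are unital. A $C^*$-algebra $\mathcal A$ is *monotone $\sigma$-complete* if every norm-bounded monotone increasing sequence of self-adjoint elements has a supremum in the ordered set $\mathcal A_{\mathrm{sa}}$ of self-adjoint elements. A $*$-homomorphism $\phi:\mathcal A\to\mathcal B$ is *$\sigma$-normal* if $\phi(\sup_n a_n)=\sup_n\phi(a_n)$ for every norm-bounded monotone increasing sequence $(a_n)$ in $\mathcal A_{\mathrm{sa}}$ that has a supremum in $\mathcal{A}_{\mathrm{sa}}$. Write $\mathsf{c}\sigma\mathsf{C}^*_\sigma$ for the category of commutative monotone $\sigma$-complete $C^*$-algebras and $\sigma$-normal $*$-homomorphisms. For $\mathcal A$ in $\mathsf{c}\sigma\mathsf{C}^*_\sigma$, $\mathsf{Proj}(\mathcal A)$ is the Boolean $\sigma$-algebra of projections of $\mathcal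 A$ with the induced order, with $p\wedge q=pq$, $p\vee q=p+q-pq$, $\neg p=1-p$, $\top = 1$, $\bot = 0$; a $\sigma$-normal $*$-homomorphism acts on it by restriction. For a Boolean algebra $B$, $\mathsf{Stone}(B)$ is the set of ultrafilters on $B$ with the topology generated by the sets $\{x : b\in x\}$, $b\in B$, and $C(\mathsf{Stone}(B))$ is the $C^*$-algebra of continuous complex-valued functions on it; a homomorphism $\phi:A\to B$ acts by $g\mapsto g\circ\mathsf{Stone}(\phi)$, where $\mathsf{Stone}(\phi)(x)=\phi^{-1}(x)$. For a Boolean $\sigma$-algebra $B$, let $\mathscr L^\infty_{\mathrm{abs}}(B)$ be the set of $\sigma$-homomorphisms $f:\mathsf{Baire}(\mathbb C)\to B$ from the Baire (equivalently, Borel) sets of $\mathbb C$ such that $f(U)=\top$ for some bounded $U\in\mathsf{Baire}(\mathbb C)$. **Theorem.** 1. For every Boolean $\sigma$-algebra $B$, the $C^*$-algebra $C(\mathsf{Stone}(B))$ is monotone $\sigma$-complete, and for every $\sigma$-homomorphism $\phi:A\to B$ of Boolean $\sigma$-algebras the induced $*$-homomorphism $C(\mathsf{Stone}(A))\to C(\mathsf{Stone}(B))$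 is $\sigma$-normal. Hence $C(\mathsf{Stone}(-))$ is a functor $\sigma\mathsf{Bool}_\sigma\to\mathsf{c}\sigma\mathsf{C}^*_\sigma$. 2. Let $B$ be a Boolean $\sigma$-algebra. For all $\sigma$-homomorphisms $f,g:\mathsf{Baire}(\mathbb C)\to B$ there is a unique $\sigma$-homomorphism $\langle f,g\rangle:\mathsf{Baire}(\mathbb C^2)\to B$ with $\langle f,g\rangle(U\times V)=f(U)\wedge g(V)$ for all $U,V\in\mathsf{Baire}(\mathbb C)$. With the operations $$(f+g)(U)=\langle f,g\rangle(\{(x,y): x+y\in U\}),\qquad (fg)(U)=\langle f,g\rangle(\{(x,y): xy\in U\}),$$ $$(\lambda f)(U)=f(\{x:\lambda x\in U\})\ \ (\lambda\in\mathbb C),\qquad f^*(U)=f(\{x:\bar x\in U\}),$$ with zero and unit the elements $0,1$ given, for $z \in\{0,1\}$, by $z(U)=\top$ if $z\in U$ and $z(U)=\bot$ otherwise, and with the norm $\|f\|=\inf\{r\ge 0: f(\{z:|z|\le r\})=\top\}$, $\mathscr L^\infty_{\mathrm{abs}}(B)$ is a commutative monotone $\sigma$-complete $C^*$-algebra. For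 every $\sigma$-homomorphism $\phi:A\to B$ of Boolean $\sigma$-algebras, $f\mapsto\phi\circ f$ is a $\sigma$-normal $*$-homomorphism $\mathscr L^\infty_{\mathrm{abs}}(A)\to\mathscr L^\infty_{\mathrm{abs}}(B)$. Hence $\mathscr L^\infty_{\mathrm{abs}}$ is a functor $\sigma\mathsf{Bool}_\sigma\to\mathsf{c}\sigma\mathsf{C}^*_\sigma$. 3. There is an equivalence of categories between $\sigma\mathsf{Bool}_\sigma$ and $\mathsf{c}\sigma\mathsf{C}^*_\sigma$ given by the functors (inverse to each other up to natural isomorphism) $C(\mathsf{Stone}(-))$ and $\mathsf{Proj}$. 4. There is an equivalence of categories between $\sigma\mathsf{Bool}_\sigma$ and $\mathsf{c}\sigma\mathsf{C}^*_\sigma$ given by the functors (inverse to each other up to natural isomorphism) $\mathscr L^\infty_{\mathrm{abs}}$ and $\mathsf{Proj}$. 5. The functors $\mathscr L^\infty_{\mathrm{abs}}$ and $C(\mathsf{Stone}(-))$ are naturally isomorphic. -/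

import Mathlib

open CategoryTheory
open scoped ComplexOrder

universe u v w

/-! ### Boolean σ-algebras -/

/-- A σ-homomorphism of Boolean algebras: a homomorphism of Boolean algebras that preserves
the suprema of sequences (whenever they exist). -/
structure SigmaHom (A : Type u) (B : Type v) [BooleanAlgebra A] [BooleanAlgebra B] extends
    BoundedLatticeHom A B where
  map_isLUB' : ∀ (p : ℕ → A) (s : A), IsLUB (Set.range p) s →
    IsLUB (Set.range fun n => toFun (p n)) (toFun s)

namespace SigmaHom

variable {A : Type u} {B : Type v} {C : Type w}
  [BooleanAlgebra A] [BooleanAlgebra B] [BooleanAlgebra C]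

instance : FunLike (SigmaHom A B) A B where
  coe f := f.toFun
  coe_injective f g h := by
    obtain ⟨f, hf⟩ := f
    obtain ⟨g, hg⟩ := g
    congr
    exact DFunLike.coe_injective h

instance : BoundedLatticeHomClass (SigmaHom A B) A B where
  map_sup f := f.map_sup'
  map_inf f := f.map_inf'
  map_top f := f.map_top'
  map_bot f := f.map_bot'

@[ext]
theorem ext {f g : SigmaHom A B} (h : ∀ a, f a = g a) : f = g := DFunLike.ext _ _ h

theorem map_isLUB (f : SigmaHom A B) {p : ℕ → A} {s : A} (h : IsLUB (Set.range p) s) :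
    IsLUB (Set.range fun n => f (p n)) (f s) := f.map_isLUB' p s h

/-- The identity σ-homomorphism. -/
def id (A : Type u) [BooleanAlgebra A] : SigmaHom A A where
  toBoundedLatticeHom := BoundedLatticeHom.id A
  map_isLUB' _ _ h := h

/-- Composition of σ-homomorphisms. -/
def comp (g : SigmaHom B C) (f : SigmaHom A B) : SigmaHom A C where
  toBoundedLatticeHom := g.toBoundedLatticeHom.comp f.toBoundedLatticeHom
  map_isLUB' _ _ h := g.map_isLUB (f.map_isLUB h)

@[simp] theorem id_apply (a : A) : SigmaHom.id A a = a := rfl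

@[simp] theorem comp_apply (g : SigmaHom B C) (f : SigmaHom A B) (a : A) :
    g.comp f a = g (f a) := rfl

end SigmaHom

/-- A Boolean σ-algebra: a Boolean algebra in which every sequence has a supremum (equivalently,
by complementation, an infimum). -/
structure SigmaBool : Type (u + 1) where
  carrier : Type u
  [booleanAlgebra : BooleanAlgebra carrier]
  exists_isLUB : ∀ p : ℕ → carrier, ∃ s, IsLUB (Set.range p) s

namespace SigmaBool

instance : CoeSort SigmaBool.{u} (Type u) := ⟨carrier⟩

attribute [instance] booleanAlgebra

/-- The category of Boolean σ-algebras and σ-homomorphisms. -/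
instance : Category SigmaBool.{u} where
  Hom A B := SigmaHom A B
  id A := SigmaHom.id A
  comp f g := SigmaHom.comp g f

end SigmaBool

/-! ### Commutative monotone σ-complete C⋆-algebras

A C⋆-algebra `A` is equipped with its usual order by the classes `PartialOrder A` and
`StarOrderedRing A`, which together determine that order. -/

/-- `a` is a norm-bounded monotone increasing sequence of self-adjoint elements with supremum `s`.
Every upper bound of a self-adjoint element is self-adjoint, so that the supremum
may be taken in `A` instead of the poset of self-adjoint elements. -/
def IncreasesTo {A : Type u} [CStarAlgebra A] [PartialOrder A] (a : ℕ → A) (s : A) : Prop :=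
  (∀ n, IsSelfAdjoint (a n)) ∧ Monotone a ∧ (∃ M : ℝ, ∀ n, ‖a n‖ ≤ M) ∧ IsLUB (Set.range a) s

/-- Monotone σ-completeness: every norm-bounded monotone increasing sequence of self-adjoint
elements has a supremum. -/
def IsMonotoneSigmaComplete (A : Type u) [CStarAlgebra A] [PartialOrder A] : Prop :=
  ∀ a : ℕ → A, (∀ n, IsSelfAdjoint (a n)) → Monotone a → (∃ M : ℝ, ∀ n, ‖a n‖ ≤ M) →
    ∃ s, IsLUB (Set.range a) s

/-- σ-normality of a (unital) ⋆-homomorphism. -/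
def IsSigmaNormal {A : Type u} {B : Type v} [CStarAlgebra A] [PartialOrder A]
    [CStarAlgebra B] [PartialOrder B] (φ : A →⋆ₐ[ℂ] B) : Prop :=
  ∀ (a : ℕ → A) (s : A), IncreasesTo a s → IncreasesTo (fun n => φ (a n)) (φ s)

/-- A commutative monotone σ-complete (unital) C⋆-algebra. -/
structure CommSigmaCStar : Type (u + 1) where
  carrier : Type u
  [commCStarAlgebra : CommCStarAlgebra carrier]
  [partialOrder : PartialOrder carrier]
  [starOrderedRing : StarOrderedRing carrier]
  sigmaComplete : IsMonotoneSigmaComplete carrier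

namespace CommSigmaCStar

instance : CoeSort CommSigmaCStar.{u} (Type u) := ⟨carrier⟩

attribute [instance] commCStarAlgebra partialOrder starOrderedRing

/-- Morphisms of commutative monotone σ-complete C⋆-algebras: σ-normal unital
⋆-homomorphisms. -/
@[ext]
structure Hom (A B : CommSigmaCStar.{u}) where
  toStarAlgHom : A →⋆ₐ[ℂ] B
  sigmaNormal : IsSigmaNormal toStarAlgHom

/-- The category of commutative monotone σ-complete C⋆-algebras and σ-normal
⋆-homomorphisms. -/
instance : Category CommSigmaCStar.{u} where
  Hom := Hom
  id A := ⟨StarAlgHom.id ℂ A, fun _ _ h => h⟩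
  comp f g := ⟨g.toStarAlgHom.comp f.toStarAlgHom,
    fun _ _ h => g.sigmaNormal _ _ (f.sigmaNormal _ _ h)⟩

end CommSigmaCStar

/-! ### Projections -/

/-- The projections (self-adjoint idempotents) of a C⋆-algebra, with the induced order. -/
abbrev Projections (A : Type u) [CStarAlgebra A] : Type u := {p : A // IsStarProjection p}

namespace Projections

section

variable {A : Type u} [CommCStarAlgebra A] [PartialOrder A] [StarOrderedRing A]

theorem le_iff {p q : Projections A} : p ≤ q ↔ (p : A) * q = p :=
  (p.2.le_tfae q.2).out 0 2

theorem isStarProjection_sup {p q : A} (hp : IsStarProjection p) (hq : IsStarProjection q) :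
    IsStarProjection (p + q - p * q) := by
  have h1 : p * p = p := hp.isIdempotentElem
  have h2 : q * q = q := hq.isIdempotentElem
  refine ⟨?_, ?_⟩
  · show (p + q - p * q) * (p + q - p * q) = p + q - p * q
    linear_combination (1 - 2 * q + q * q) * h1 + (1 - p) * h2
  · show star (p + q - p * q) = p + q - p * q
    rw [star_sub, star_add, star_mul, hp.isSelfAdjoint.star_eq, hq.isSelfAdjoint.star_eq,
      mul_comm q p]

/-- The Boolean algebra of projections, with `p ⊓ q = p * q`, `p ⊔ q = p + q - p * q`,
`pᶜ = 1 - p`, `⊤ = 1`, `⊥ = 0` and the order induced by the C⋆-algebra. -/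
instance : BooleanAlgebra (Projections A) where
  inf p q := ⟨p.1 * q.1, p.2.mul q.2 (Commute.all _ _)⟩
  sup p q := ⟨p.1 + q.1 - p.1 * q.1, isStarProjection_sup p.2 q.2⟩
  compl p := ⟨1 - p.1, p.2.one_sub⟩
  top := ⟨1, .one _⟩
  bot := ⟨0, .zero _⟩
  le_sup_left p q := by
    have h1 : p.1 * p.1 = p.1 := p.2.isIdempotentElem
    rw [le_iff]
    show p.1 * (p.1 + q.1 - p.1 * q.1) = p.1
    linear_combination (1 - q.1) * h1
  le_sup_right p q := by
    have h2 : q.1 * q.1 = q.1 := q.2.isIdempotentElem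
    rw [le_iff]
    show q.1 * (p.1 + q.1 - p.1 * q.1) = q.1
    linear_combination (1 - p.1) * h2
  sup_le p q r h1 h2 := by
    rw [le_iff] at *
    show (p.1 + q.1 - p.1 * q.1) * r.1 = p.1 + q.1 - p.1 * q.1
    linear_combination (1 - q.1) * h1 + h2
  inf_le_left p q := by
    have h1 : p.1 * p.1 = p.1 := p.2.isIdempotentElem
    rw [le_iff]
    show p.1 * q.1 * p.1 = p.1 * q.1
    linear_combination q.1 * h1
  inf_le_right p q := by
    have h2 : q.1 * q.1 = q.1 := q.2.isIdempotentElem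
    rw [le_iff]
    show p.1 * q.1 * q.1 = p.1 * q.1
    linear_combination p.1 * h2
  le_inf p q r h1 h2 := by
    rw [le_iff] at *
    show p.1 * (q.1 * r.1) = p.1
    linear_combination r.1 * h1 + h2
  le_sup_inf p q r := by
    have h1 : p.1 * p.1 = p.1 := p.2.isIdempotentElem
    refine le_of_eq (Subtype.ext ?_)
    show (p.1 + q.1 - p.1 * q.1) * (p.1 + r.1 - p.1 * r.1) =
      p.1 + q.1 * r.1 - p.1 * (q.1 * r.1)
    linear_combination (1 - q.1 - r.1 + q.1 * r.1) * h1
  inf_compl_le_bot p := by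
    have h1 : p.1 * p.1 = p.1 := p.2.isIdempotentElem
    refine le_of_eq (Subtype.ext ?_)
    show p.1 * (1 - p.1) = 0
    linear_combination -h1
  top_le_sup_compl p := by
    have h1 : p.1 * p.1 = p.1 := p.2.isIdempotentElem
    refine le_of_eq (Subtype.ext ?_)
    show 1 = p.1 + (1 - p.1) - p.1 * (1 - p.1)
    linear_combination -h1
  le_top p := p.2.le_one
  bot_le p := p.2.nonneg

theorem norm_le_one (p : Projections A) : ‖(p : A)‖ ≤ 1 :=
  (CStarAlgebra.norm_le_one_iff_of_nonneg (p : A) p.2.nonneg).2 p.2.le_one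

/-- The supremum of an increasing sequence of projections is a projection. -/
theorem isStarProjection_of_isLUB {p : ℕ → Projections A} {t : A}
    (ht : IsLUB (Set.range fun n => (p n : A)) t) : IsStarProjection t := by
  have hle : ∀ n, (p n : A) ≤ t := fun n => ht.1 ⟨n, rfl⟩
  have h0 : 0 ≤ t := (p 0).2.nonneg.trans (hle 0)
  have h1 : t ≤ 1 := ht.2 (by rintro _ ⟨n, rfl⟩; exact (p n).2.le_one)
  have hsa : IsSelfAdjoint t := h0.isSelfAdjoint
  have hmul : ∀ n, (p n : A) * t = p n := by
    intro n
    have h := ((p n).2.one_sub.mul_right_and_mul_left_of_nonneg_of_le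
      (sub_nonneg.2 h1) (sub_le_sub_left (hle n) 1)).1
    linear_combination h
  have hub : t ≤ t * t := by
    refine ht.2 ?_
    rintro _ ⟨n, rfl⟩
    have h := star_left_conjugate_nonneg (p n).2.one_sub.nonneg t
    rw [hsa.star_eq] at h
    refine sub_nonneg.1 (h.trans_eq ?_)
    show t * (1 - (p n : A)) * t = t * t - p n
    linear_combination (-t - 1) * hmul n
  have hlb : t * t ≤ t := by
    refine sub_nonneg.1 ?_
    have h := Left.mul_nonneg h0 (sub_nonneg.2 h1)
    rwa [mul_sub, mul_one] at h
  exact ⟨le_antisymm hlb hub, hsa⟩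

theorem isLUB_partialSups {α : Type u} [Lattice α] (p : ℕ → α) (s : α) :
    IsLUB (Set.range (partialSups p)) s ↔ IsLUB (Set.range p) s := by
  unfold IsLUB
  rw [upperBounds_range_partialSups]

/-- Over a monotone σ-complete algebra, the supremum of an increasing sequence of projections
exists both in the algebra and in the poset of projections, and the two agree. -/
theorem exists_increasesTo (hA : IsMonotoneSigmaComplete A) {p : ℕ → Projections A}
    (hp : Monotone p) :
    ∃ s : Projections A, IsLUB (Set.range p) s ∧ IncreasesTo (fun n => (p n : A)) (s : A) := by
  have hsa : ∀ n, IsSelfAdjoint (p n : A) := fun n => (p n).2.isSelfAdjoint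
  have hb : ∃ M : ℝ, ∀ n, ‖(p n : A)‖ ≤ M := ⟨1, fun n => norm_le_one _⟩
  obtain ⟨t, ht⟩ := hA (fun n => (p n : A)) hsa hp hb
  refine ⟨⟨t, isStarProjection_of_isLUB ht⟩, ⟨?_, ?_⟩, hsa, hp, hb, ht⟩
  · rintro _ ⟨n, rfl⟩
    exact ht.1 ⟨n, rfl⟩
  · intro q hq
    refine ht.2 ?_
    rintro _ ⟨n, rfl⟩
    exact hq ⟨n, rfl⟩

theorem exists_isLUB (hA : IsMonotoneSigmaComplete A) (p : ℕ → Projections A) :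
    ∃ s, IsLUB (Set.range p) s := by
  obtain ⟨s, hs, -⟩ := exists_increasesTo hA (partialSups p).monotone
  exact ⟨s, (isLUB_partialSups p s).1 hs⟩

end

variable {A : Type u} {B : Type v} [CommCStarAlgebra A] [PartialOrder A] [StarOrderedRing A]
  [CommCStarAlgebra B] [PartialOrder B] [StarOrderedRing B]

/-- The homomorphism of Boolean algebras induced by a ⋆-homomorphism. -/
def mapHom (φ : A →⋆ₐ[ℂ] B) : BoundedLatticeHom (Projections A) (Projections B) where
  toFun p := ⟨φ p.1, p.2.map φ⟩
  map_sup' p q := Subtype.ext <| by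
    show φ (p.1 + q.1 - p.1 * q.1) = φ p.1 + φ q.1 - φ p.1 * φ q.1
    rw [map_sub, map_add, map_mul]
  map_inf' p q := Subtype.ext (map_mul φ p.1 q.1)
  map_top' := Subtype.ext (map_one φ)
  map_bot' := Subtype.ext (map_zero φ)

/-- The σ-homomorphism on projections induced by a σ-normal ⋆-homomorphism. -/
def map (hA : IsMonotoneSigmaComplete A) (φ : A →⋆ₐ[ℂ] B) (hφ : IsSigmaNormal φ) :
    SigmaHom (Projections A) (Projections B) where
  toBoundedLatticeHom := mapHom φ
  map_isLUB' p s hs := by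
    obtain ⟨t, ht, ht'⟩ := exists_increasesTo hA (partialSups p).monotone
    obtain rfl : t = s := ht.unique ((isLUB_partialSups p s).2 hs)
    obtain ⟨-, -, -, h⟩ := hφ _ _ ht'
    refine ⟨?_, ?_⟩
    · rintro _ ⟨n, rfl⟩
      exact OrderHomClass.mono (mapHom φ) (hs.1 ⟨n, rfl⟩)
    · intro q hq
      refine h.2 ?_
      rintro _ ⟨n, rfl⟩
      have hn : mapHom φ (partialSups p n) ≤ q := by
        induction n with
        | zero => rw [partialSups_zero]; exact hq ⟨0, rfl⟩
        | succ n ih =>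
          rw [partialSups_add_one, map_sup]
          exact sup_le ih (hq ⟨n + 1, rfl⟩)
      exact hn

end Projections

/-- The functor `Proj`, sending a commutative monotone σ-complete C⋆-algebra to its Boolean
σ-algebra of projections and a σ-normal ⋆-homomorphism to its restriction to projections. -/
def projFunctor : CommSigmaCStar.{u} ⥤ SigmaBool.{u} where
  obj A := ⟨Projections A, Projections.exists_isLUB A.sigmaComplete⟩
  map {A _} φ := Projections.map A.sigmaComplete φ.toStarAlgHom φ.sigmaNormal

/-! ### Stone spaces -/

/-- The Stone space of a Boolean algebra: the set of its ultrafilters. -/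
@[ext]
structure Stone (B : Type u) [BooleanAlgebra B] : Type u where
  carrier : Set B
  top_mem : ⊤ ∈ carrier
  inf_mem : ∀ a b, a ∈ carrier → b ∈ carrier → a ⊓ b ∈ carrier
  mem_of_le : ∀ a b, a ≤ b → a ∈ carrier → b ∈ carrier
  compl_mem_iff : ∀ a, aᶜ ∈ carrier ↔ a ∉ carrier

namespace Stone

variable {A : Type u} {B : Type v} [BooleanAlgebra A] [BooleanAlgebra B]

/-- The basic clopen set of ultrafilters containing `b`. -/
def basic (b : B) : Set (Stone B) := {x | b ∈ x.carrier}

/-- The Stone topology, generated by the basic clopen sets. -/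
instance : TopologicalSpace (Stone B) :=
  TopologicalSpace.generateFrom (Set.range basic)

theorem isOpen_basic (b : B) : IsOpen (basic b) :=
  TopologicalSpace.isOpen_generateFrom_of_mem ⟨b, rfl⟩

instance : CompactSpace (Stone B) where
  isCompact_univ := by
    rw [isCompact_iff_ultrafilter_le_nhds]
    intro F _
    refine ⟨⟨{b | basic b ∈ F}, ?_, ?_, ?_, ?_⟩, Set.mem_univ _, ?_⟩
    · exact Filter.mem_of_superset Filter.univ_mem fun x _ => x.top_mem
    · exact fun a b ha hb => Filter.mem_of_superset (Filter.inter_mem ha hb)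
        fun x hx => x.inf_mem a b hx.1 hx.2
    · exact fun a b hab ha => Filter.mem_of_superset ha fun x hx => x.mem_of_le a b hab hx
    · intro a
      show basic aᶜ ∈ F ↔ basic a ∉ F
      rw [← Ultrafilter.compl_mem_iff_notMem]
      have : basic aᶜ = (basic a)ᶜ := Set.ext fun x => x.compl_mem_iff a
      rw [this]
    · rw [TopologicalSpace.nhds_generateFrom]
      refine le_iInf₂ ?_
      rintro _ ⟨hx, b, rfl⟩
      exact Filter.le_principal_iff.2 hx

instance : T2Space (Stone B) where
  t2 := by
    have key : ∀ x y : Stone B, ∀ b ∈ x.carrier, b ∉ y.carrier →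
        ∃ u v : Set (Stone B), IsOpen u ∧ IsOpen v ∧ x ∈ u ∧ y ∈ v ∧ Disjoint u v := by
      intro x y b hx hy
      refine ⟨basic b, basic bᶜ, isOpen_basic b, isOpen_basic bᶜ, hx,
        (y.compl_mem_iff b).2 hy, Set.disjoint_left.2 fun z hz hz' => ?_⟩
      exact (z.compl_mem_iff b).1 hz' hz
    intro x y hxy
    obtain ⟨b, hb⟩ : ∃ b, ¬(b ∈ x.carrier ↔ b ∈ y.carrier) := by
      by_contra! h
      exact hxy (Stone.ext (Set.ext h))
    by_cases hx : b ∈ x.carrier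
    · exact key x y b hx fun hy => hb ⟨fun _ => hy, fun _ => hx⟩
    · have hy : b ∈ y.carrier := by
        by_contra hy
        exact hb ⟨fun h => absurd h hx, fun h => absurd h hy⟩
      exact key x y bᶜ ((x.compl_mem_iff b).2 hx) fun h => (y.compl_mem_iff b).1 h hy

/-- The continuous map of Stone spaces induced by a homomorphism of Boolean algebras. -/
def comap (φ : BoundedLatticeHom A B) : C(Stone B, Stone A) where
  toFun x :=
    { carrier := {a | φ a ∈ x.carrier}
      top_mem := by
        show φ ⊤ ∈ x.carrier
        rw [map_top]
        exact x.top_mem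
      inf_mem := fun a b ha hb => by
        show φ (a ⊓ b) ∈ x.carrier
        rw [map_inf]
        exact x.inf_mem _ _ ha hb
      mem_of_le := fun a b hab ha => x.mem_of_le _ _ (OrderHomClass.mono φ hab) ha
      compl_mem_iff := fun a => by
        show φ aᶜ ∈ x.carrier ↔ φ a ∉ x.carrier
        rw [map_compl']
        exact x.compl_mem_iff _ }
  continuous_toFun := by
    refine continuous_generateFrom_iff.2 ?_
    rintro _ ⟨a, rfl⟩
    exact isOpen_basic (φ a)

/-- The ⋆-homomorphism `C(Stone A) → C(Stone B)` induced by a homomorphism `A → B`. -/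
noncomputable def pullback (φ : BoundedLatticeHom A B) :
    C(Stone A, ℂ) →⋆ₐ[ℂ] C(Stone B, ℂ) :=
  ContinuousMap.compStarAlgHom' ℂ ℂ (comap φ)

end Stone

/-- The functor `C(Stone(-))` from Boolean σ-algebras to commutative monotone σ-complete
C⋆-algebras, for which it has to be known that `C(Stone B)` is monotone σ-complete for every
Boolean σ-algebra `B` and that σ-homomorphisms induce σ-normal ⋆-homomorphisms. -/
noncomputable def cStoneFunctor
    (hobj : ∀ B : SigmaBool.{u}, IsMonotoneSigmaComplete C(Stone B, ℂ))
    (hmap : ∀ (A B : SigmaBool.{u}) (φ : SigmaHom A B),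
      IsSigmaNormal (Stone.pullback φ.toBoundedLatticeHom)) :
    SigmaBool.{u} ⥤ CommSigmaCStar.{u} where
  obj B := ⟨C(Stone B, ℂ), hobj B⟩
  map {A B} φ := ⟨Stone.pullback φ.toBoundedLatticeHom, hmap A B φ⟩

/-! ### The abstract `L^∞` construction -/

/-- The Boolean σ-algebra of measurable subsets of a measurable space. For `ℂ` and `ℂ × ℂ` these
are the Borel (equivalently, Baire) sets. -/
abbrev MeasSets (X : Type u) [MeasurableSpace X] : Type u :=
  Subtype (MeasurableSet : Set X → Prop)

/-- The σ-homomorphism `U ↦ f ⁻¹' U` given by a measurable map `f`. -/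
noncomputable def MeasSets.preimage {X : Type u} {Y : Type v} [MeasurableSpace X] [MeasurableSpace Y]
    (f : X → Y) (hf : Measurable f) : SigmaHom (MeasSets Y) (MeasSets X) where
  toFun U := ⟨f ⁻¹' U.1, hf U.2⟩
  map_sup' _ _ := rfl
  map_inf' _ _ := rfl
  map_top' := rfl
  map_bot' := rfl
  map_isLUB' p s hs := by
    have hU : s = ⟨⋃ n, (p n).1, MeasurableSet.iUnion fun n => (p n).2⟩ := by
      refine hs.unique ⟨?_, ?_⟩
      · rintro _ ⟨n, rfl⟩
        exact Set.subset_iUnion (fun n => (p n).1) n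
      · intro q hq
        exact Set.iUnion_subset fun n => hq ⟨n, rfl⟩
    subst hU
    refine ⟨?_, ?_⟩
    · rintro _ ⟨n, rfl⟩
      exact Set.preimage_mono (Set.subset_iUnion (fun n => (p n).1) n)
    · intro q hq x hx
      obtain ⟨n, hn⟩ := Set.mem_iUnion.1 hx
      exact hq ⟨n, rfl⟩ hn

/-- The elements of the abstract `L^∞` of `B`: σ-homomorphisms from the Borel sets of `ℂ` to `B`
with bounded support. -/
@[ext]
structure LinfAbs (B : Type u) [BooleanAlgebra B] : Type u where
  toSigmaHom : SigmaHom (MeasSets ℂ) B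
  bounded : ∃ U : MeasSets ℂ, Bornology.IsBounded U.1 ∧ toSigmaHom U = ⊤

namespace LinfAbs

variable {A : Type u} {B : Type u} [BooleanAlgebra A] [BooleanAlgebra B]

/-- `ρ` is the pairing `⟨f, g⟩` of `f` and `g`. -/
def IsPairing (f g : SigmaHom (MeasSets ℂ) B) (ρ : SigmaHom (MeasSets (ℂ × ℂ)) B) : Prop :=
  ∀ U V : MeasSets ℂ, ρ ⟨U.1 ×ˢ V.1, U.2.prod V.2⟩ = f U ⊓ g V

/-- Any two σ-homomorphisms from the Borel sets of `ℂ` to `B` have a unique pairing. -/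
def HasPairings (B : Type u) [BooleanAlgebra B] : Prop :=
  ∀ f g : SigmaHom (MeasSets ℂ) B, ∃! ρ : SigmaHom (MeasSets (ℂ × ℂ)) B, IsPairing f g ρ

/-- The pairing `⟨f, g⟩`. -/
noncomputable def pairing (h : HasPairings B) (f g : SigmaHom (MeasSets ℂ) B) :
    SigmaHom (MeasSets (ℂ × ℂ)) B := (h f g).choose

theorem isPairing_pairing (h : HasPairings B) (f g : SigmaHom (MeasSets ℂ) B) :
    IsPairing f g (pairing h f g) := (h f g).choose_spec.1

/-- The element `U ↦ ⟨f, g⟩ (m ⁻¹' U)`, for a binary operation `m` on `ℂ`. -/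
noncomputable def binop (h : HasPairings B) (m : ℂ × ℂ → ℂ) (hm : Continuous m)
    (f g : LinfAbs B) : LinfAbs B where
  toSigmaHom := (pairing h f.toSigmaHom g.toSigmaHom).comp (MeasSets.preimage m hm.measurable)
  bounded := by
    obtain ⟨U, hU, hfU⟩ := f.bounded
    obtain ⟨V, hV, hgV⟩ := g.bounded
    have hK : IsCompact (m '' (closure U.1 ×ˢ closure V.1)) :=
      (hU.isCompact_closure.prod hV.isCompact_closure).image hm
    refine ⟨⟨_, hK.measurableSet⟩, hK.isBounded, top_le_iff.1 ?_⟩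
    have h1 := isPairing_pairing h f.toSigmaHom g.toSigmaHom U V
    rw [hfU, hgV, top_inf_eq] at h1
    rw [← h1]
    refine OrderHomClass.mono (pairing h f.toSigmaHom g.toSigmaHom) ?_
    exact fun z hz => ⟨z, ⟨subset_closure hz.1, subset_closure hz.2⟩, rfl⟩

/-- The element `U ↦ f (m ⁻¹' U)`, for a unary operation `m` on `ℂ`. -/
noncomputable def unop (m : ℂ → ℂ) (hm : Continuous m) (f : LinfAbs B) : LinfAbs B where
  toSigmaHom := f.toSigmaHom.comp (MeasSets.preimage m hm.measurable)
  bounded := by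
    obtain ⟨U, hU, hfU⟩ := f.bounded
    have hK : IsCompact (m '' closure U.1) := hU.isCompact_closure.image hm
    refine ⟨⟨_, hK.measurableSet⟩, hK.isBounded, top_le_iff.1 ?_⟩
    rw [← hfU]
    refine OrderHomClass.mono f.toSigmaHom ?_
    exact fun z hz => ⟨z, subset_closure hz, rfl⟩

open Classical in
/-- The constant `z`: the element with `U ↦ ⊤` if `z ∈ U` and `U ↦ ⊥` otherwise. -/
noncomputable def const (B : Type u) [BooleanAlgebra B] (z : ℂ) : LinfAbs B where
  toSigmaHom :=
    { toFun := fun U => if z ∈ U.1 then ⊤ else ⊥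
      map_sup' := fun U V => by
        by_cases hU : z ∈ U.1 <;> by_cases hV : z ∈ V.1 <;> simp [hU, hV]
      map_inf' := fun U V => by
        by_cases hU : z ∈ U.1 <;> by_cases hV : z ∈ V.1 <;> simp [hU, hV]
      map_top' := by simp
      map_bot' := by simp
      map_isLUB' := fun p s hs => by
        have hU : s = ⟨⋃ n, (p n).1, MeasurableSet.iUnion fun n => (p n).2⟩ := by
          refine hs.unique ⟨?_, ?_⟩
          · rintro _ ⟨n, rfl⟩
            exact Set.subset_iUnion (fun n => (p n).1) n
          · intro q hq
            exact Set.iUnion_subset fun n => hq ⟨n, rfl⟩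
        subst hU
        refine ⟨?_, ?_⟩
        · rintro _ ⟨n, rfl⟩
          by_cases hn : z ∈ (p n).1
          · have : z ∈ ⋃ n, (p n).1 := Set.mem_iUnion.2 ⟨n, hn⟩
            simp only [this, if_true]
            exact le_top
          · simp only [hn, if_false]
            exact bot_le
        · intro q hq
          by_cases hz : z ∈ ⋃ n, (p n).1
          · obtain ⟨n, hn⟩ := Set.mem_iUnion.1 hz
            have h1 := hq ⟨n, rfl⟩
            simp only [hn, if_true] at h1
            simp only [hz, if_true]
            exact h1
          · simp only [hz, if_false]
            exact bot_le }
  bounded := ⟨⟨{z}, measurableSet_singleton z⟩, Bornology.isBounded_singleton, if_pos rfl⟩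

/-- A monotone σ-complete C⋆-algebra structure on the abstract `L^∞` of `B` whose operations and
norm are the canonical ones. They are given by:
* `0` and `1` are the constants;
* `(f + g) U = ⟨f, g⟩ {(x, y) | x + y ∈ U}` and `(f * g) U = ⟨f, g⟩ {(x, y) | x * y ∈ U}`;
* `(c • f) U = f {x | c * x ∈ U}`, which is `f (c⁻¹ U)` for `c ≠ 0`, and
  `(star f) U = f {x | conj x ∈ U}`;
* `‖f‖` is the infimum of all `r ≥ 0` such that `f` takes the closed ball of radius `r` around
  `0` to `⊤`. -/
structure CStarStructure (B : Type u) [BooleanAlgebra B] (h : HasPairings B) where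
  [commCStarAlgebra : CommCStarAlgebra (LinfAbs B)]
  [partialOrder : PartialOrder (LinfAbs B)]
  [starOrderedRing : StarOrderedRing (LinfAbs B)]
  zero_def : (0 : LinfAbs B) = const B 0
  one_def : (1 : LinfAbs B) = const B 1
  add_def : ∀ f g : LinfAbs B, f + g = binop h (fun z => z.1 + z.2) (by fun_prop) f g
  mul_def : ∀ f g : LinfAbs B, f * g = binop h (fun z => z.1 * z.2) (by fun_prop) f g
  smul_def : ∀ (c : ℂ) (f : LinfAbs B), c • f = unop (fun z => c * z) (by fun_prop) f
  star_def : ∀ f : LinfAbs B, star f = unop (fun z => star z) continuous_star f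
  norm_def : ∀ f : LinfAbs B, ‖f‖ =
    sInf {r : ℝ | 0 ≤ r ∧ f.toSigmaHom ⟨Metric.closedBall 0 r, measurableSet_closedBall⟩ = ⊤}
  sigmaComplete : IsMonotoneSigmaComplete (LinfAbs B)

/-- The commutative monotone σ-complete C⋆-algebra given by a structure on `LinfAbs B`. -/
def CStarStructure.toCommSigmaCStar {h : HasPairings B} (S : CStarStructure B h) :
    CommSigmaCStar.{u} :=
  letI := S.commCStarAlgebra
  letI := S.partialOrder
  letI := S.starOrderedRing
  ⟨LinfAbs B, S.sigmaComplete⟩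

/-- Postcomposition with a σ-homomorphism. -/
noncomputable def map (φ : SigmaHom A B) (f : LinfAbs A) : LinfAbs B where
  toSigmaHom := φ.comp f.toSigmaHom
  bounded := by
    obtain ⟨U, hU, hfU⟩ := f.bounded
    refine ⟨U, hU, ?_⟩
    rw [SigmaHom.comp_apply, hfU, map_top]

end LinfAbs

/-- The functor `L^∞_abs` from Boolean σ-algebras to commutative monotone σ-complete C⋆-algebras,
acting on morphisms by postcomposition, for which it has to be known that the canonical
operations and norm on `L^∞_abs(B)` are those of such a C⋆-algebra and that postcomposition with
a σ-homomorphism is a σ-normal ⋆-homomorphism. -/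
noncomputable def linfAbsFunctor (hpair : ∀ B : SigmaBool.{u}, LinfAbs.HasPairings B)
    (S : ∀ B : SigmaBool.{u}, LinfAbs.CStarStructure B (hpair B))
    (hmap : ∀ (A B : SigmaBool.{u}) (φ : SigmaHom A B),
      ∃ ψ : (S A).toCommSigmaCStar ⟶ (S B).toCommSigmaCStar,
        ∀ f : LinfAbs A, ψ.toStarAlgHom f = LinfAbs.map φ f) :
    SigmaBool.{u} ⥤ CommSigmaCStar.{u} where
  obj B := (S B).toCommSigmaCStar
  map {A B} φ := (hmap A B φ).choose
  map_id A := by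
    refine CommSigmaCStar.Hom.ext (StarAlgHom.ext fun f => ?_)
    exact ((hmap A A (𝟙 A)).choose_spec f).trans rfl
  map_comp {A B C} φ χ := by
    refine CommSigmaCStar.Hom.ext (StarAlgHom.ext fun f => ?_)
    refine ((hmap A C (φ ≫ χ)).choose_spec f).trans ?_
    have h1 := (hmap A B φ).choose_spec f
    have h2 := (hmap B C χ).choose_spec (LinfAbs.map φ f)
    exact h2.symm.trans (congrArg (hmap B C χ).choose.toStarAlgHom h1.symm)

/-!
Let `X = Stone B` for a Boolean σ-algebra `B`, with the σ-algebra of Baire sets generated by the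
basic clopen sets. The supremum of a sequence in `B` and the union of the corresponding basic sets
differ by a nowhere dense set (`Stone.basic_eventuallyEq_iUnion`), and by the Baire category theorem
no two basic sets agree up to a meagre set. Hence every Baire set differs from exactly one basic
set by a meagre set, which gives the σ-homomorphism `Stone.loomisSikorski` from the Baire sets of
`X` to `B`. It is natural in `B`, as this can be tested on the basic sets.

A measurable function `g : X → ℂ` therefore has a law `U ↦ [g ⁻¹' U]`, a σ-homomorphism from the
Borel sets to `B`, which determines `g` up to a meagre set. Conversely a bounded σ-homomorphism `f`
is the law of the continuous function sending an ultrafilter `x` to the limit of the ultrafilter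
`{U | f U ∈ x}` on the Borel sets (`Stone.exists_continuous_law_eq`). A Borel isomorphism of `ℂ`
with the open unit disc shows that an unbounded `f` is the law of a measurable function.

* Pairings are joint laws, and they are unique because σ-homomorphisms on a σ-algebra are determined
  on generators (`LinfAbs.hasPairings`).
* Taking laws is a natural bijection from `C(X, ℂ)` to `L^∞_abs(B)` under which the operations
  given by pairings are the pointwise ones; the C⋆-structure is transported along it
  (`LinfAbs.cstarStructure`, `LinfAbs.natIso`).
* The pointwise supremum of a bounded increasing sequence in `C(X, ℂ)` is measurable, so it has the
  law of a continuous function, which agrees with it off a meagre set and is the supremum in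
  `C(X, ℂ)`. This characterisation of suprema is preserved by σ-homomorphisms because
  `Stone.loomisSikorski` is natural (`Stone.isSigmaNormal_pullback`).

For the equivalence with `Proj`, the projections of `C(X, ℂ)` are the indicator functions of the
clopen sets, which form `B` again. For the other composite let `A` be a commutative monotone
σ-complete C⋆-algebra. Its projections separate characters (`exists_projection_separating`), so that
`χ ↦ {p | χ p = 1}` is a homeomorphism from the character space of `A` to `Stone (Proj A)`, and
Gelfand duality identifies `C(Stone (Proj A), ℂ)` with `A`. The statement for `L^∞_abs` follows by
replacing the functor in this equivalence with an isomorphic one.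
-/

section

open Filter Topology Set

/-! ### σ-homomorphisms on algebras of measurable sets -/


namespace MeasSets

variable {X : Type v} [m : MeasurableSpace X] {B : Type u} [BooleanAlgebra B]

theorem isLUB_iUnion (p : ℕ → MeasSets X) :
    IsLUB (range p) ⟨⋃ n, (p n).1, MeasurableSet.iUnion fun n => (p n).2⟩ := by
  refine ⟨?_, fun q hq => iUnion_subset fun n => hq ⟨n, rfl⟩⟩
  rintro _ ⟨n, rfl⟩
  exact subset_iUnion (fun n => (p n).1) n

/-- σ-homomorphisms defined on the measurable sets are determined by their values on a
generating family. -/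
theorem hom_ext {C : Set (Set X)} (hC : m = MeasurableSpace.generateFrom C)
    (f g : SigmaHom (MeasSets X) B)
    (h : ∀ (U : Set X) (hU : MeasurableSet U), U ∈ C → f ⟨U, hU⟩ = g ⟨U, hU⟩) : f = g := by
  have key : ∀ U : Set X, @MeasurableSet X (MeasurableSpace.generateFrom C) U →
      ∀ hU : MeasurableSet U, f ⟨U, hU⟩ = g ⟨U, hU⟩ := by
    refine fun U hU => MeasurableSpace.generateFrom_induction C
      (fun U _ => ∀ hU : MeasurableSet U, f ⟨U, hU⟩ = g ⟨U, hU⟩)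
      (fun U hUC _ hU => h U hU hUC) ?_ ?_ ?_ U hU
    · exact fun _ => (BotHomClass.map_bot f).trans (BotHomClass.map_bot g).symm
    · intro U _ ih hU
      have := congrArg compl (ih hU.of_compl)
      rwa [← map_compl', ← map_compl'] at this
    · intro s hs ih hU
      have hs' : ∀ n, MeasurableSet (s n) := fun n => by rw [hC]; exact hs n
      refine (f.map_isLUB (MeasSets.isLUB_iUnion fun n => ⟨s n, hs' n⟩)).unique ?_
      simp_rw [fun n => ih n (hs' n)]
      exact g.map_isLUB (MeasSets.isLUB_iUnion fun n => ⟨s n, hs' n⟩)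
  exact SigmaHom.ext fun U => key U.1 (by rw [← hC]; exact U.2) U.2

end MeasSets

/-! ### Baire sets of the Stone space -/

namespace Stone

section Basic

variable {B : Type u} [BooleanAlgebra B]

theorem mem_basic {b : B} {x : Stone B} : x ∈ basic b ↔ b ∈ x.carrier := Iff.rfl

theorem basic_mono {a b : B} (h : a ≤ b) : basic a ⊆ basic b := fun x hx => x.mem_of_le _ _ h hx

theorem basic_compl (b : B) : basic bᶜ = (basic b)ᶜ := Set.ext fun x => x.compl_mem_iff b

theorem basic_inf (a b : B) : basic (a ⊓ b) = basic a ∩ basic b :=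
  (subset_inter (basic_mono inf_le_left) (basic_mono inf_le_right)).antisymm
    fun x hx => x.inf_mem _ _ hx.1 hx.2

theorem basic_top : basic (⊤ : B) = univ := eq_univ_of_forall fun x => x.top_mem

theorem basic_bot : basic (⊥ : B) = ∅ := by
  rw [← compl_top, basic_compl, basic_top, compl_univ]

theorem basic_sup (a b : B) : basic (a ⊔ b) = basic a ∪ basic b := by
  rw [← compl_compl (a ⊔ b), compl_sup, basic_compl, basic_inf, basic_compl, basic_compl,
    compl_inter, compl_compl, compl_compl]

theorem isClosed_basic (b : B) : IsClosed (basic b) := by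
  rw [← compl_compl b, basic_compl]
  exact (isOpen_basic _).isClosed_compl

/-- The ultrafilter theorem: a nonzero element lies in some ultrafilter. -/
theorem basic_nonempty {b : B} (hb : b ≠ ⊥) : (basic b).Nonempty := by
  have hdis : Disjoint ((Order.PFilter.principal b : Order.PFilter B) : Set B)
      ((Order.Ideal.principal ⊥ : Order.Ideal B) : Set B) := by
    refine disjoint_left.2 fun x hx hx' => hb ?_
    exact le_bot_iff.1 (le_trans (Order.PFilter.mem_principal.1 hx) hx')
  obtain ⟨J, hJ, -, hFJ⟩ := DistribLattice.prime_ideal_of_disjoint_filter_ideal hdis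
  have hc : ∀ {x y : B}, x ⊓ y ∈ J → x ∈ J ∨ y ∈ J := fun h => hJ.mem_or_mem h
  have ht : (⊤ : B) ∉ J := J.top_notMem_iff_ne_top.2 hJ.1.ne_top
  refine ⟨⟨{x | x ∉ J}, ht, fun a b ha hb h => (hc h).elim ha hb,
    fun a b hab ha hb => ha (J.lower hab hb), fun a => ?_⟩, ?_⟩
  · refine ⟨fun h h' => ?_, fun h h' => ht ?_⟩
    · have : a ⊓ aᶜ ∈ J := by rw [inf_compl_eq_bot]; exact J.bot_mem
      exact (hc this).elim h' h
    · rw [← sup_compl_eq_top (x := a)]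
      exact J.sup_mem (not_not.1 h) h'
  · exact fun h => disjoint_left.1 hFJ (Order.PFilter.mem_principal.2 le_rfl) h

theorem basic_subset_basic {a b : B} : basic a ⊆ basic b ↔ a ≤ b := by
  refine ⟨fun h => ?_, basic_mono⟩
  by_contra hab
  obtain ⟨x, hx⟩ := basic_nonempty (b := a ⊓ bᶜ) fun h' => hab (by
    rwa [← disjoint_iff, disjoint_compl_right_iff] at h')
  rw [basic_inf, basic_compl] at hx
  exact hx.2 (h hx.1)

theorem isTopologicalBasis_basic :
    TopologicalSpace.IsTopologicalBasis (range (basic : B → Set (Stone B))) := by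
  refine TopologicalSpace.isTopologicalBasis_of_subbasis_of_finiteInter rfl ⟨⟨⊤, basic_top⟩, ?_⟩
  rintro _ ⟨a, rfl⟩ _ ⟨b, rfl⟩
  exact ⟨a ⊓ b, basic_inf a b⟩

/-- Between a compact set and an open set there is a basic set. -/
theorem exists_basic_between {K O : Set (Stone B)} (hK : IsCompact K) (hO : IsOpen O)
    (h : K ⊆ O) : ∃ b : B, K ⊆ basic b ∧ basic b ⊆ O := by
  refine hK.induction_on (p := fun s => ∃ b : B, s ⊆ basic b ∧ basic b ⊆ O) ?_ ?_ ?_ ?_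
  · exact ⟨⊥, empty_subset _, by rw [basic_bot]; exact empty_subset _⟩
  · rintro s t hst ⟨b, hb, hb'⟩
    exact ⟨b, hst.trans hb, hb'⟩
  · rintro s t ⟨a, ha, ha'⟩ ⟨b, hb, hb'⟩
    exact ⟨a ⊔ b, by rw [basic_sup]; exact union_subset_union ha hb,
      by rw [basic_sup]; exact union_subset ha' hb'⟩
  · intro x hx
    obtain ⟨_, ⟨b, rfl⟩, hxb, hbO⟩ :=
      isTopologicalBasis_basic.exists_subset_of_mem_open (h hx) hO
    exact ⟨basic b, mem_nhdsWithin_of_mem_nhds ((isOpen_basic b).mem_nhds hxb), b, Subset.rfl, hbO⟩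

theorem exists_eq_basic {S : Set (Stone B)} (hS : IsClopen S) : ∃ b : B, S = basic b := by
  obtain ⟨b, h1, h2⟩ := exists_basic_between hS.1.isCompact hS.2 Subset.rfl
  exact ⟨b, h1.antisymm h2⟩

/-- The Stone space carries the σ-algebra generated by the basic clopen sets, that is, its
σ-algebra of Baire sets. -/
instance : MeasurableSpace (Stone B) := MeasurableSpace.generateFrom (range basic)

theorem measurableSet_basic (b : B) : MeasurableSet (basic b) :=
  MeasurableSpace.measurableSet_generateFrom ⟨b, rfl⟩

theorem measurable_of_continuous {Y : Type v} [TopologicalSpace Y]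
    [TopologicalSpace.PseudoMetrizableSpace Y] [MeasurableSpace Y] [BorelSpace Y]
    {g : Stone B → Y} (hg : Continuous g) : Measurable g := by
  let := TopologicalSpace.pseudoMetrizableSpacePseudoMetric Y
  refine measurable_of_isOpen fun U hU => ?_
  obtain ⟨F, hF, hFU, rfl, -⟩ := hU.exists_iUnion_isClosed
  choose b hb hb' using fun n => exists_basic_between ((hF n).preimage hg).isCompact
    (hU.preimage hg) (preimage_mono (hFU n))
  have : g ⁻¹' (⋃ n, F n) = ⋃ n, basic (b n) := by
    refine Subset.antisymm ?_ (iUnion_subset hb')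
    rw [preimage_iUnion]
    exact iUnion_mono hb
  rw [this]
  exact MeasurableSet.iUnion fun n => measurableSet_basic _

theorem measurable_comap {A : Type v} [BooleanAlgebra A] (φ : BoundedLatticeHom A B) :
    Measurable (comap φ) := by
  refine measurable_generateFrom ?_
  rintro _ ⟨a, rfl⟩
  exact measurableSet_basic (φ a)

/-- The supremum of a sequence in `B` corresponds to the union of the basic sets up to a
meagre set: the difference is closed and contains no nonempty basic set. -/
theorem basic_eventuallyEq_iUnion {p : ℕ → B} {s : B} (hs : IsLUB (range p) s) :
    basic s =ᶠ[residual (Stone B)] ⋃ n, basic (p n) := by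
  have hsub : ⋃ n, basic (p n) ⊆ basic s := iUnion_subset fun n => basic_mono (hs.1 ⟨n, rfl⟩)
  have hres : (⋃ n, basic (p n)) ∪ (basic s)ᶜ ∈ residual (Stone B) := by
    refine residual_of_dense_open ((isOpen_iUnion fun n => isOpen_basic _).union
      (isClosed_basic s).isOpen_compl) (isTopologicalBasis_basic.dense_iff.2 ?_)
    rintro _ ⟨c, rfl⟩ hne
    by_contra hcon
    rw [not_nonempty_iff_eq_empty, ← disjoint_iff_inter_eq_empty, disjoint_union_right,
      disjoint_compl_right_iff_subset, basic_subset_basic, disjoint_iUnion_right] at hcon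
    have hle : s ≤ cᶜ := by
      refine hs.2 ?_
      rintro _ ⟨n, rfl⟩
      rw [← basic_subset_basic, basic_compl]
      exact (hcon.1 n).symm.subset_compl_right
    obtain rfl : c = ⊥ := by simpa using hcon.2.trans hle
    rw [basic_bot] at hne
    exact not_nonempty_empty hne
  filter_upwards [hres] with x hx
  exact propext ⟨fun h => hx.resolve_right fun h' => h' h, fun h => hsub h⟩

/-- Two basic sets that agree up to a meagre set are equal, by the Baire category theorem. -/
theorem eq_of_basic_eventuallyEq {a b : B} (h : basic a =ᶠ[residual (Stone B)] basic b) :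
    a = b := by
  have key : ∀ {a b : B}, basic a =ᶠ[residual (Stone B)] basic b → a ≤ b := by
    intro a b h
    rw [← basic_subset_basic]
    by_contra hab
    obtain ⟨x, hx, hxb⟩ := not_subset.1 hab
    obtain ⟨y, hy, hy'⟩ := (dense_of_mem_residual h).inter_open_nonempty
      (basic a ∩ (basic b)ᶜ) ((isOpen_basic a).inter (isClosed_basic b).isOpen_compl) ⟨x, hx, hxb⟩
    exact hy.2 (hy'.mp hy.1)
  exact (key h).antisymm (key h.symm)

end Basic

/-! ### The Loomis–Sikorski homomorphism -/

theorem exists_eventuallyEq_basic (B : SigmaBool.{u}) {S : Set (Stone B)}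
    (hS : MeasurableSet S) : ∃ b : B, S =ᶠ[residual (Stone B)] basic b := by
  refine MeasurableSpace.generateFrom_induction (range basic)
    (fun S _ => ∃ b : B, S =ᶠ[residual (Stone B)] basic b) ?_ ?_ ?_ ?_ S hS
  · rintro _ ⟨b, rfl⟩ -
    exact ⟨b, EventuallyEq.rfl⟩
  · exact ⟨⊥, by rw [basic_bot]; exact EventuallyEq.rfl⟩
  · rintro S - ⟨b, hb⟩
    exact ⟨bᶜ, by rw [basic_compl]; exact hb.compl⟩
  · rintro S - hb
    choose b hb using hb
    obtain ⟨s, hs⟩ := B.exists_isLUB b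
    exact ⟨s, (Filter.EventuallyEq.countable_iUnion hb).trans (basic_eventuallyEq_iUnion hs).symm⟩

/-- The element of `B` whose basic set differs from `S` by a meagre set. -/
noncomputable def baireClass (B : SigmaBool.{u}) (S : MeasSets (Stone B)) : B :=
  (exists_eventuallyEq_basic B S.2).choose

theorem eventuallyEq_baireClass {B : SigmaBool.{u}} (S : MeasSets (Stone B)) :
    S.1 =ᶠ[residual (Stone B)] basic (baireClass B S) :=
  (exists_eventuallyEq_basic B S.2).choose_spec

theorem baireClass_eq_iff {B : SigmaBool.{u}} {S : MeasSets (Stone B)} {b : B} :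
    baireClass B S = b ↔ S.1 =ᶠ[residual (Stone B)] basic b :=
  ⟨fun h => h ▸ eventuallyEq_baireClass S,
    fun h => eq_of_basic_eventuallyEq ((eventuallyEq_baireClass S).symm.trans h)⟩

/-- The Loomis–Sikorski homomorphism: every Boolean σ-algebra is the quotient of the Baire sets
of its Stone space by the meagre ones. -/
noncomputable def loomisSikorski (B : SigmaBool.{u}) : SigmaHom (MeasSets (Stone B)) B where
  toFun := baireClass B
  map_sup' S T := by
    rw [baireClass_eq_iff, basic_sup]
    exact (eventuallyEq_baireClass S).union (eventuallyEq_baireClass T)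
  map_inf' S T := by
    rw [baireClass_eq_iff, basic_inf]
    exact (eventuallyEq_baireClass S).inter (eventuallyEq_baireClass T)
  map_top' := by
    rw [baireClass_eq_iff, basic_top]
    exact EventuallyEq.rfl
  map_bot' := by
    rw [baireClass_eq_iff, basic_bot]
    exact EventuallyEq.rfl
  map_isLUB' p s hs := by
    obtain rfl := hs.unique (MeasSets.isLUB_iUnion p)
    obtain ⟨t, ht⟩ := B.exists_isLUB fun n => baireClass B (p n)
    convert! ht
    rw [baireClass_eq_iff]
    exact (Filter.EventuallyEq.countable_iUnion fun n => eventuallyEq_baireClass (p n)).trans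
      (basic_eventuallyEq_iUnion ht).symm

theorem loomisSikorski_eq_iff {B : SigmaBool.{u}} {S : MeasSets (Stone B)} {b : B} :
    loomisSikorski B S = b ↔ S.1 =ᶠ[residual (Stone B)] basic b := baireClass_eq_iff

theorem loomisSikorski_basic {B : SigmaBool.{u}} (b : B) :
    loomisSikorski B ⟨basic b, measurableSet_basic b⟩ = b :=
  loomisSikorski_eq_iff.2 EventuallyEq.rfl

theorem loomisSikorski_eq_top_iff {B : SigmaBool.{u}} {S : MeasSets (Stone B)} :
    loomisSikorski B S = ⊤ ↔ S.1 ∈ residual (Stone B) := by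
  rw [loomisSikorski_eq_iff, basic_top, eventuallyEq_univ]

theorem loomisSikorski_eq_loomisSikorski_iff {B : SigmaBool.{u}} {S T : MeasSets (Stone B)} :
    loomisSikorski B S = loomisSikorski B T ↔ S.1 =ᶠ[residual (Stone B)] T.1 := by
  rw [loomisSikorski_eq_iff]
  have := eventuallyEq_baireClass T
  exact ⟨fun h => h.trans this.symm, fun h => h.trans this⟩

/-- The Loomis–Sikorski homomorphism is natural. -/
theorem comp_loomisSikorski {A B : SigmaBool.{u}} (φ : SigmaHom A B) :
    φ.comp (loomisSikorski A) = (loomisSikorski B).comp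
      (MeasSets.preimage (comap φ.toBoundedLatticeHom) (measurable_comap _)) := by
  refine MeasSets.hom_ext rfl _ _ ?_
  rintro _ hU ⟨a, rfl⟩
  exact (congrArg φ (loomisSikorski_basic a)).trans (loomisSikorski_basic (φ a)).symm

/-- The preimage of a Baire set with meagre complement under the map induced by a σ-homomorphism
has meagre complement. This fails for general sets and for general homomorphisms. -/
theorem preimage_comap_mem_residual {A B : SigmaBool.{u}} (φ : SigmaHom A B)
    {S : Set (Stone A)} (hm : MeasurableSet S) (hS : S ∈ residual (Stone A)) :
    comap φ.toBoundedLatticeHom ⁻¹' S ∈ residual (Stone B) := by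
  have h := DFunLike.congr_fun (comp_loomisSikorski φ) ⟨S, hm⟩
  rw [SigmaHom.comp_apply, loomisSikorski_eq_top_iff.2 hS, TopHomClass.map_top] at h
  exact loomisSikorski_eq_top_iff.1 h.symm

end Stone

/-! ### σ-homomorphisms from Borel sets are given by functions on the Stone space -/

namespace Stone

variable {B : SigmaBool.{u}}

/-- The σ-homomorphism `U ↦ [g ⁻¹' U]` given by a Baire measurable function `g` on the Stone
space. Like the law of a random variable, it forgets what happens on meagre sets. -/
noncomputable def law {Y : Type v} [MeasurableSpace Y] (g : Stone B → Y) (hg : Measurable g) :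
    SigmaHom (MeasSets Y) B :=
  (loomisSikorski B).comp (MeasSets.preimage g hg)

theorem law_comp {Y : Type v} {Z : Type w} [MeasurableSpace Y] [MeasurableSpace Z]
    (g : Stone B → Y) (hg : Measurable g) (h : Y → Z) (hh : Measurable h) :
    law (h ∘ g) (hh.comp hg) = (law g hg).comp (MeasSets.preimage h hh) := rfl

theorem law_eq_top_iff {Y : Type v} [MeasurableSpace Y] {g : Stone B → Y} (hg : Measurable g)
    (U : MeasSets Y) : law g hg U = ⊤ ↔ ∀ᶠ x in residual (Stone B), g x ∈ U.1 :=
  loomisSikorski_eq_top_iff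

theorem law_eq_law_iff {g h : Stone B → ℂ} (hg : Measurable g) (hh : Measurable h) :
    law g hg = law h hh ↔ g =ᶠ[residual (Stone B)] h := by
  constructor
  · intro hgh
    have hb := TopologicalSpace.isBasis_countableBasis ℂ
    have hev : ∀ᶠ x in residual (Stone B), ∀ U ∈ TopologicalSpace.countableBasis ℂ,
        (g x ∈ U ↔ h x ∈ U) := by
      refine (eventually_countable_ball (TopologicalSpace.countable_countableBasis ℂ)).2 ?_
      intro U hU
      have hm : MeasurableSet U := (hb.isOpen hU).measurableSet
      have h1 := loomisSikorski_eq_loomisSikorski_iff.1 (DFunLike.congr_fun hgh ⟨U, hm⟩)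
      filter_upwards [h1] with x hx
      exact iff_of_eq hx
    filter_upwards [hev] with x hx
    exact hb.eq_iff.2 hx
  · intro hgh
    refine SigmaHom.ext fun U => loomisSikorski_eq_loomisSikorski_iff.2 ?_
    filter_upwards [hgh] with x hx
    refine propext ?_
    show g x ∈ U.1 ↔ h x ∈ U.1
    rw [hx]

theorem eq_of_eventuallyEq {g h : Stone B → ℂ} (hg : Continuous g) (hh : Continuous h)
    (hgh : g =ᶠ[residual (Stone B)] h) : g = h :=
  Continuous.ext_on (dense_of_mem_residual hgh) hg hh fun _ hx => hx

/-- An ultrafilter on `B` turns a bounded σ-homomorphism into an ultrafilter on the Borel sets of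
`ℂ`, which converges. -/
theorem exists_limit (f : SigmaHom (MeasSets ℂ) B)
    (hf : ∃ U : MeasSets ℂ, Bornology.IsBounded U.1 ∧ f U = ⊤) (x : Stone B) :
    ∃ z : ℂ, ∀ (V : Set ℂ) (hV : IsOpen V), z ∈ V → f ⟨V, hV.measurableSet⟩ ∈ x.carrier := by
  by_contra! hcon
  obtain ⟨U, hU, hfU⟩ := hf
  obtain ⟨W, hW, hUW, hWx⟩ : ∃ (W : Set ℂ) (hW : MeasurableSet W), closure U.1 ⊆ W ∧
      f ⟨W, hW⟩ ∉ x.carrier := by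
    refine hU.isCompact_closure.induction_on
      (p := fun s => ∃ (W : Set ℂ) (hW : MeasurableSet W), s ⊆ W ∧ f ⟨W, hW⟩ ∉ x.carrier)
      ?_ ?_ ?_ ?_
    · refine ⟨∅, .empty, Subset.rfl, fun h => ?_⟩
      have h' : f ⊥ ∈ x.carrier := h
      rw [BotHomClass.map_bot, ← mem_basic, basic_bot] at h'
      exact h'
    · rintro s t hst ⟨W, hW, htW, h⟩
      exact ⟨W, hW, hst.trans htW, h⟩
    · rintro s t ⟨W, hW, hsW, h⟩ ⟨W', hW', htW', h'⟩
      refine ⟨W ∪ W', hW.union hW', union_subset_union hsW htW', fun hx => ?_⟩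
      have hx' : f (⟨W, hW⟩ ⊔ ⟨W', hW'⟩) ∈ x.carrier := hx
      rw [SupHomClass.map_sup, ← mem_basic, basic_sup] at hx'
      exact hx'.elim h h'
    · intro z _
      obtain ⟨V, hV, hzV, h⟩ := hcon z
      exact ⟨V, mem_nhdsWithin_of_mem_nhds (hV.mem_nhds hzV), V, hV.measurableSet, Subset.rfl, h⟩
  refine hWx (x.mem_of_le (f U) _ (OrderHomClass.mono f (subset_closure.trans hUW)) ?_)
  rw [hfU]
  exact x.top_mem

/-- Every bounded σ-homomorphism on the Borel sets of `ℂ` is the law of a continuous function,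
whose value at an ultrafilter is the limit of the latter along the σ-homomorphism. -/
theorem exists_continuous_law_eq (f : SigmaHom (MeasSets ℂ) B)
    (hf : ∃ U : MeasSets ℂ, Bornology.IsBounded U.1 ∧ f U = ⊤) :
    ∃ g : C(Stone B, ℂ), law g (measurable_of_continuous g.continuous) = f := by
  choose g hg using exists_limit f hf
  have hcl : ∀ W : MeasSets ℂ, basic (f W) ⊆ g ⁻¹' closure W.1 := by
    intro W x hx
    by_contra hgx
    have h1 := hg x (closure W.1)ᶜ isClosed_closure.isOpen_compl hgx
    have h2 := x.inf_mem _ _ hx h1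
    have h3 : W ⊓ ⟨(closure W.1)ᶜ, isClosed_closure.isOpen_compl.measurableSet⟩ = ⊥ :=
      Subtype.ext (disjoint_compl_right.mono_left subset_closure).inter_eq
    rw [← InfHomClass.map_inf, h3, BotHomClass.map_bot, ← mem_basic, basic_bot] at h2
    exact h2
  have hcont : Continuous g := by
    refine continuous_def.2 fun U hU => isOpen_iff_mem_nhds.2 fun x hx => ?_
    obtain ⟨ε, hε, hεU⟩ := Metric.nhds_basis_closedBall.mem_iff.1 (hU.mem_nhds hx)
    refine mem_of_superset ((isOpen_basic _).mem_nhds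
      (hg x _ Metric.isOpen_ball (Metric.mem_ball_self hε))) ((hcl _).trans ?_)
    exact preimage_mono (Metric.closure_ball_subset_closedBall.trans hεU)
  refine ⟨⟨g, hcont⟩, MeasSets.hom_ext BorelSpace.measurable_eq
    _ _ fun U hm hU => le_antisymm ?_ ?_⟩
  · refine (OrderHomClass.mono (loomisSikorski B) ?_).trans (loomisSikorski_basic _).le
    exact fun x hx => hg x U hU hx
  -- The open set `U` is a countable union of closed sets, on which `hcl` is sharp.
  · obtain ⟨F, hF, hFU, hUF, -⟩ :=
      IsOpen.exists_iUnion_isClosed (U := U) hU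
    have hlub := f.map_isLUB (MeasSets.isLUB_iUnion fun n => ⟨F n, (hF n).measurableSet⟩)
    have hU' : (⟨⋃ n, F n, MeasurableSet.iUnion fun n => (hF n).measurableSet⟩ : MeasSets ℂ) =
        ⟨U, hm⟩ := Subtype.ext hUF
    rw [hU'] at hlub
    refine hlub.2 ?_
    rintro _ ⟨n, rfl⟩
    refine (loomisSikorski_basic _).ge.trans (OrderHomClass.mono (loomisSikorski B) ?_)
    refine (hcl _).trans (preimage_mono ?_)
    exact (hF n).closure_eq.subset.trans (hFU n)

/-- Every σ-homomorphism on the Borel sets of `ℂ` is the law of a Baire measurable function: the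
Borel isomorphism `z ↦ z / (1 + ‖z‖)` of `ℂ` onto the unit disc reduces this to the bounded case. -/
theorem exists_measurable_law_eq (f : SigmaHom (MeasSets ℂ) B) :
    ∃ (g : Stone B → ℂ) (hg : Measurable g), law g hg = f := by
  let h : ℂ → ℂ := fun z => z / (1 + ‖z‖ : ℝ)
  let k : ℂ → ℂ := fun w => w / (1 - ‖w‖ : ℝ)
  have hh : Measurable h := by fun_prop
  have hk : Measurable k := by fun_prop
  have hpos : ∀ z : ℂ, 0 < 1 + ‖z‖ := fun z => by positivity
  have hnorm : ∀ z, ‖h z‖ = ‖z‖ / (1 + ‖z‖) := fun z => by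
    rw [norm_div, Complex.norm_real, Real.norm_of_nonneg (hpos z).le]
  have hkh : k ∘ h = id := by
    funext z
    have hz : 1 - ‖h z‖ = (1 + ‖z‖)⁻¹ := by
      rw [hnorm]
      field_simp [(hpos z).ne']
      ring
    show h z / (1 - ‖h z‖ : ℝ) = z
    rw [hz, Complex.ofReal_inv, div_inv_eq_mul, div_mul_cancel₀]
    exact Complex.ofReal_ne_zero.2 (hpos z).ne'
  obtain ⟨g, hg⟩ := exists_continuous_law_eq (f.comp (MeasSets.preimage h hh))
    ⟨⟨Metric.closedBall 0 1, measurableSet_closedBall⟩, Metric.isBounded_closedBall, by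
      rw [← TopHomClass.map_top f]
      refine congrArg f (Subtype.ext (eq_univ_of_forall fun z => ?_))
      show h z ∈ Metric.closedBall 0 1
      rw [mem_closedBall_zero_iff, hnorm, div_le_one (hpos z)]
      linarith⟩
  refine ⟨k ∘ g, hk.comp (measurable_of_continuous g.continuous), ?_⟩
  rw [law_comp g (measurable_of_continuous g.continuous) k hk, hg]
  refine SigmaHom.ext fun U => congrArg f (Subtype.ext ?_)
  show h ⁻¹' (k ⁻¹' U.1) = U.1
  rw [← preimage_comp, hkh, preimage_id]

/-- The joint law of two functions is a pairing of their laws. -/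
theorem isPairing_law {g h : Stone B → ℂ} (hg : Measurable g) (hh : Measurable h) :
    LinfAbs.IsPairing (law g hg) (law h hh) (law (fun x => (g x, h x)) (hg.prodMk hh)) :=
  fun U V => InfHomClass.map_inf (loomisSikorski B)
    (MeasSets.preimage g hg U) (MeasSets.preimage h hh V)

end Stone

namespace LinfAbs

open Stone

theorem hasPairings (B : SigmaBool.{u}) : HasPairings B := by
  intro f g
  obtain ⟨f, hf, rfl⟩ := exists_measurable_law_eq f
  obtain ⟨g, hg, rfl⟩ := exists_measurable_law_eq g
  refine ⟨_, isPairing_law hf hg, fun ρ hρ => MeasSets.hom_ext generateFrom_prod.symm _ _ ?_⟩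
  rintro _ _ ⟨U, hU, V, hV, rfl⟩
  exact (hρ ⟨U, hU⟩ ⟨V, hV⟩).trans (isPairing_law hf hg ⟨U, hU⟩ ⟨V, hV⟩).symm

theorem pairing_law {B : SigmaBool.{u}} {g h : Stone B → ℂ} (hg : Measurable g)
    (hh : Measurable h) : pairing (hasPairings B) (law g hg) (law h hh) =
      law (fun x => (g x, h x)) (hg.prodMk hh) :=
  (hasPairings B _ _).unique (isPairing_pairing _ _ _) (isPairing_law hg hh)

variable {B : SigmaBool.{u}}

/-- The law of a continuous function on the Stone space, as an element of the abstract `L^∞`. -/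
noncomputable def ofContinuous (g : C(Stone B, ℂ)) : LinfAbs B where
  toSigmaHom := law g (measurable_of_continuous g.continuous)
  bounded := ⟨⟨Metric.closedBall 0 ‖g‖, measurableSet_closedBall⟩, Metric.isBounded_closedBall,
    (law_eq_top_iff _ _).2 <| Eventually.of_forall fun x =>
      mem_closedBall_zero_iff.2 (g.norm_coe_le_norm x)⟩

theorem ofContinuous_bijective : Function.Bijective (ofContinuous (B := B)) := by
  constructor
  · intro g h hgh
    have := (law_eq_law_iff _ _).1 (congrArg LinfAbs.toSigmaHom hgh)
    exact DFunLike.coe_injective (eq_of_eventuallyEq g.continuous h.continuous this)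
  · intro f
    obtain ⟨g, hg⟩ := exists_continuous_law_eq f.toSigmaHom f.bounded
    exact ⟨g, LinfAbs.ext hg⟩

/-- The abstract `L^∞` of `B` in terms of continuous functions on the Stone space. -/
noncomputable def equivContinuous (B : SigmaBool.{u}) : LinfAbs B ≃ C(Stone B, ℂ) :=
  (Equiv.ofBijective ofContinuous ofContinuous_bijective).symm

theorem equivContinuous_symm_apply (g : C(Stone B, ℂ)) :
    (equivContinuous B).symm g = ofContinuous g := rfl

theorem binop_ofContinuous (m : ℂ × ℂ → ℂ) (hm : Continuous m) (g h : C(Stone B, ℂ)) :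
    binop (hasPairings B) m hm (ofContinuous g) (ofContinuous h) =
      ofContinuous ⟨fun x => m (g x, h x), by fun_prop⟩ := by
  refine LinfAbs.ext ?_
  exact congrArg (fun ρ => SigmaHom.comp ρ (MeasSets.preimage m hm.measurable))
    (pairing_law (measurable_of_continuous g.continuous) (measurable_of_continuous h.continuous))

theorem unop_ofContinuous (m : ℂ → ℂ) (hm : Continuous m) (g : C(Stone B, ℂ)) :
    unop m hm (ofContinuous g) = ofContinuous ⟨fun x => m (g x), by fun_prop⟩ := rfl

theorem const_eq_ofContinuous (z : ℂ) : const B z = ofContinuous (ContinuousMap.const _ z) := by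
  refine LinfAbs.ext (SigmaHom.ext fun U => ?_)
  by_cases hz : z ∈ U.1
  · exact (if_pos hz).trans
      ((law_eq_top_iff _ _).2 (Eventually.of_forall fun _ => hz)).symm
  · refine (if_neg hz).trans ((loomisSikorski_eq_iff (B := B)).2 ?_).symm
    rw [basic_bot]
    exact Eventually.of_forall fun _ => propext ⟨fun h => hz h, False.elim⟩

theorem norm_ofContinuous (g : C(Stone B, ℂ)) :
    ‖g‖ = sInf {r : ℝ | 0 ≤ r ∧
      (ofContinuous g).toSigmaHom ⟨Metric.closedBall 0 r, measurableSet_closedBall⟩ = ⊤} := by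
  have key : ∀ r : ℝ, 0 ≤ r → ((ofContinuous g).toSigmaHom
      ⟨Metric.closedBall 0 r, measurableSet_closedBall⟩ = ⊤ ↔ ‖g‖ ≤ r) := by
    intro r hr
    refine (law_eq_top_iff _ _).trans ⟨fun h => (ContinuousMap.norm_le g hr).2 fun x => ?_,
      fun h => Eventually.of_forall fun x => ?_⟩
    · have hc : IsClosed (g ⁻¹' Metric.closedBall 0 r) :=
        Metric.isClosed_closedBall.preimage g.continuous
      have hx : x ∈ g ⁻¹' Metric.closedBall 0 r := by
        rw [← hc.closure_eq]
        exact dense_of_mem_residual h x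
      exact mem_closedBall_zero_iff.1 hx
    · exact mem_closedBall_zero_iff.2 ((g.norm_coe_le_norm x).trans h)
  have hset : {r : ℝ | 0 ≤ r ∧ (ofContinuous g).toSigmaHom
      ⟨Metric.closedBall 0 r, measurableSet_closedBall⟩ = ⊤} = Ici ‖g‖ := by
    ext r
    refine ⟨fun h => (key r h.1).1 h.2, fun h => ?_⟩
    have hr : 0 ≤ r := (norm_nonneg g).trans h
    exact ⟨hr, (key r hr).2 h⟩
  rw [hset, csInf_Ici]

theorem map_ofContinuous {A B : SigmaBool.{u}} (φ : SigmaHom A B) (g : C(Stone A, ℂ)) :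
    map φ (ofContinuous g) = ofContinuous (pullback φ.toBoundedLatticeHom g) := by
  refine LinfAbs.ext ?_
  exact congrArg (fun ρ => SigmaHom.comp ρ
    (MeasSets.preimage g (measurable_of_continuous g.continuous))) (comp_loomisSikorski φ)

end LinfAbs

/-! ### Suprema of sequences of continuous functions on the Stone space -/

namespace Stone

variable {B : SigmaBool.{u}}

theorem le_of_eventually_le {g h : C(Stone B, ℂ)}
    (hgh : ∀ᶠ x in residual (Stone B), g x ≤ h x) : g ≤ h := by
  intro x
  have hc : IsClosed {x | g x ≤ h x} := isClosed_le g.continuous h.continuous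
  have hx : x ∈ closure {x | g x ≤ h x} := dense_of_mem_residual hgh x
  rwa [hc.closure_eq] at hx

/-- The pointwise supremum of a sequence of real-valued functions. -/
noncomputable def supFun {X : Type v} (a : ℕ → X → ℂ) (x : X) : ℂ := ((⨆ n, (a n x).re : ℝ) : ℂ)

theorem isLUB_supFun {X : Type v} [TopologicalSpace X] [CompactSpace X] {a : ℕ → C(X, ℂ)}
    (hsa : ∀ n, IsSelfAdjoint (a n)) (hb : ∃ M : ℝ, ∀ n, ‖a n‖ ≤ M) (x : X) :
    IsLUB (range fun n => a n x) (supFun (fun n => a n) x) := by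
  obtain ⟨M, hM⟩ := hb
  have hre : ∀ n, a n x = ((a n x).re : ℂ) := fun n =>
    (Complex.conj_eq_iff_re.1 (DFunLike.congr_fun (hsa n) x)).symm
  have hbdd : BddAbove (range fun n => (a n x).re) := by
    refine ⟨M, ?_⟩
    rintro _ ⟨n, rfl⟩
    exact (Complex.re_le_norm _).trans (((a n).norm_coe_le_norm x).trans (hM n))
  refine ⟨?_, fun z hz => ?_⟩
  · rintro _ ⟨n, rfl⟩
    show a n x ≤ _
    rw [hre n]
    exact Complex.real_le_real.2 (le_ciSup hbdd n)
  · have hz' : ∀ n, (a n x).re ≤ z.re := fun n => (Complex.le_def.1 (hz ⟨n, rfl⟩)).1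
    refine Complex.le_def.2 ⟨ciSup_le hz', ?_⟩
    have := (Complex.le_def.1 (hz ⟨0, rfl⟩)).2
    simp only at this
    rw [hre 0, Complex.ofReal_im] at this
    exact this

theorem measurable_supFun {X : Type v} [MeasurableSpace X] {a : ℕ → X → ℂ}
    (ha : ∀ n, Measurable (a n)) : Measurable (supFun a) :=
  Complex.measurable_ofReal.comp
    (Measurable.iSup fun n => Complex.measurable_re.comp (ha n))

/-- A continuous function that agrees with the pointwise supremum off a meagre set is the
supremum. -/
theorem isLUB_of_eventuallyEq {a : ℕ → C(Stone B, ℂ)} (hsa : ∀ n, IsSelfAdjoint (a n))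
    (hb : ∃ M : ℝ, ∀ n, ‖a n‖ ≤ M) {s : C(Stone B, ℂ)}
    (hs : s =ᶠ[residual (Stone B)] supFun fun n => a n) : IsLUB (range a) s := by
  refine ⟨?_, fun t ht => le_of_eventually_le ?_⟩
  · rintro _ ⟨n, rfl⟩
    refine le_of_eventually_le ?_
    filter_upwards [hs] with x hx
    rw [hx]
    exact (isLUB_supFun hsa hb x).1 ⟨n, rfl⟩
  · filter_upwards [hs] with x hx
    rw [hx]
    refine (isLUB_supFun hsa hb x).2 ?_
    rintro _ ⟨n, rfl⟩
    exact ht ⟨n, rfl⟩ x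

theorem exists_eventuallyEq_supFun {a : ℕ → C(Stone B, ℂ)}
    (hb : ∃ M : ℝ, ∀ n, ‖a n‖ ≤ M) :
    ∃ s : C(Stone B, ℂ), s =ᶠ[residual (Stone B)] supFun fun n => a n := by
  have hm : Measurable (supFun fun n => (a n : Stone B → ℂ)) :=
    measurable_supFun fun n => measurable_of_continuous (a n).continuous
  obtain ⟨M, hM⟩ := hb
  obtain ⟨s, hs⟩ := exists_continuous_law_eq (law _ hm) ⟨⟨Metric.closedBall 0 M,
    measurableSet_closedBall⟩, Metric.isBounded_closedBall,
    (law_eq_top_iff _ _).2 <| Eventually.of_forall fun x => by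
      rw [mem_closedBall_zero_iff, supFun, Complex.norm_real, Real.norm_eq_abs]
      have hbd : ∀ n, |(a n x).re| ≤ M := fun n =>
        (Complex.abs_re_le_norm _).trans (((a n).norm_coe_le_norm x).trans (hM n))
      refine abs_le.2 ⟨(abs_le.1 (hbd 0)).1.trans (le_ciSup (f := fun n => (a n x).re) ⟨M, ?_⟩ 0),
        ciSup_le fun n => (abs_le.1 (hbd n)).2⟩
      rintro _ ⟨n, rfl⟩
      exact (abs_le.1 (hbd n)).2⟩
  exact ⟨s, (law_eq_law_iff _ hm).1 hs⟩

theorem isLUB_iff_eventuallyEq {a : ℕ → C(Stone B, ℂ)} (hsa : ∀ n, IsSelfAdjoint (a n))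
    (hb : ∃ M : ℝ, ∀ n, ‖a n‖ ≤ M) {s : C(Stone B, ℂ)} :
    IsLUB (range a) s ↔ s =ᶠ[residual (Stone B)] supFun fun n => a n := by
  refine ⟨fun h => ?_, isLUB_of_eventuallyEq hsa hb⟩
  obtain ⟨t, ht⟩ := exists_eventuallyEq_supFun hb
  obtain rfl := h.unique (isLUB_of_eventuallyEq hsa hb ht)
  exact ht

theorem isMonotoneSigmaComplete (B : SigmaBool.{u}) : IsMonotoneSigmaComplete C(Stone B, ℂ) := by
  intro a hsa _ hb
  obtain ⟨s, hs⟩ := exists_eventuallyEq_supFun hb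
  exact ⟨s, isLUB_of_eventuallyEq hsa hb hs⟩

/-- The supremum is characterised by a Baire set with meagre complement, and such sets are
preserved under preimage along σ-homomorphisms. -/
theorem isSigmaNormal_pullback {A B : SigmaBool.{u}} (φ : SigmaHom A B) :
    IsSigmaNormal (pullback φ.toBoundedLatticeHom) := by
  rintro a s ⟨hsa, hmono, ⟨M, hM⟩, hs⟩
  have hsa' : ∀ n, IsSelfAdjoint (pullback φ.toBoundedLatticeHom (a n)) := fun n =>
    (hsa n).map (pullback φ.toBoundedLatticeHom)
  have hb' : ∀ n, ‖pullback φ.toBoundedLatticeHom (a n)‖ ≤ M := fun n =>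
    (NonUnitalStarAlgHom.norm_apply_le _ _).trans (hM n)
  refine ⟨hsa', fun i j hij x => hmono hij _, ⟨M, hb'⟩, isLUB_of_eventuallyEq hsa' ⟨M, hb'⟩ ?_⟩
  have hs' := (isLUB_iff_eventuallyEq hsa ⟨M, hM⟩).1 hs
  exact preimage_comap_mem_residual φ (measurableSet_eq_fun
    (measurable_of_continuous s.continuous)
    (measurable_supFun fun n => measurable_of_continuous (a n).continuous)) hs'

end Stone

/-! ### The C⋆-algebra structure of the abstract `L^∞` -/

/-- A ⋆-homomorphism that is an order isomorphism is σ-normal. -/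
theorem isSigmaNormal_of_orderIso {A : Type u} {B : Type v} [CStarAlgebra A] [PartialOrder A]
    [CStarAlgebra B] [PartialOrder B] (φ : A →⋆ₐ[ℂ] B) (e : A ≃o B) (he : ∀ a, e a = φ a) :
    IsSigmaNormal φ := by
  rintro a s ⟨hsa, hmono, ⟨M, hM⟩, hs⟩
  refine ⟨fun n => (hsa n).map φ, fun i j hij => ?_,
    ⟨M, fun n => (NonUnitalStarAlgHom.norm_apply_le φ _).trans (hM n)⟩, ?_⟩
  · simp only [← he]
    exact e.monotone (hmono hij)
  · have h := e.isLUB_image'.2 hs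
    rw [← range_comp] at h
    simp only [Function.comp_def, he] at h
    exact h

namespace CommSigmaCStar

/-- A ⋆-isomorphism is an order isomorphism, hence σ-normal in both directions. -/
def isoOfStarAlgEquiv {A B : CommSigmaCStar.{u}} (e : A ≃⋆ₐ[ℂ] B) : A ≅ B where
  hom := ⟨(e : A →⋆ₐ[ℂ] B), isSigmaNormal_of_orderIso _
    (OrderIsoClass.toOrderIso e) fun _ => rfl⟩
  inv := ⟨(e.symm : B →⋆ₐ[ℂ] A), isSigmaNormal_of_orderIso _
    (OrderIsoClass.toOrderIso e.symm) fun _ => rfl⟩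
  hom_inv_id := Hom.ext (StarAlgHom.ext fun a => e.symm_apply_apply a)
  inv_hom_id := Hom.ext (StarAlgHom.ext fun a => e.apply_symm_apply a)

end CommSigmaCStar

namespace LinfAbs

section

variable (B : SigmaBool.{u})

/-- The ring structure transported from `C(Stone B, ℂ)`. -/
noncomputable abbrev commRing : CommRing (LinfAbs B) := (equivContinuous B).commRing

/-- The norm transported from `C(Stone B, ℂ)`. -/
noncomputable abbrev normedCommRing : NormedCommRing (LinfAbs B) :=
  letI := commRing B
  NormedCommRing.induced _ _ (equivContinuous B).ringEquiv (equivContinuous B).injective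

/-- The C⋆-algebra structure transported from `C(Stone B, ℂ)`. -/
noncomputable abbrev commCStarAlgebra : CommCStarAlgebra (LinfAbs B) :=
  let e := equivContinuous B
  letI := normedCommRing B
  letI : StarRing (LinfAbs B) := e.starRing
  letI : Algebra ℂ (LinfAbs B) := e.algebra ℂ
  haveI : StarModule ℂ (LinfAbs B) := e.starModule ℂ
  have hiso : Isometry e := Isometry.of_dist_eq fun f g => by
    rw [dist_eq_norm, dist_eq_norm]
    exact congrArg norm (map_sub e.ringEquiv f g).symm
  letI : NormedAlgebra ℂ (LinfAbs B) :=
    { norm_smul_le := fun c f => by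
        show ‖e (e.symm (c • e f))‖ ≤ ‖c‖ * ‖e f‖
        rw [e.apply_symm_apply]
        exact norm_smul_le _ _ }
  haveI : CompleteSpace (LinfAbs B) :=
    (completeSpace_congr (e := e) hiso.isUniformEmbedding).2 inferInstance
  haveI : CStarRing (LinfAbs B) := ⟨fun f => by
    show ‖e f‖ * ‖e f‖ ≤ ‖e (e.symm (e (e.symm (star (e f))) * e f))‖
    rw [e.apply_symm_apply, e.apply_symm_apply]
    exact CStarRing.norm_mul_self_le _⟩
  { }

/-- The pointwise order of functions on the Stone space. -/
noncomputable abbrev partialOrder : PartialOrder (LinfAbs B) :=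
  PartialOrder.lift (equivContinuous B) (equivContinuous B).injective

/-- `equivContinuous` as an isomorphism of ⋆-algebras. -/
noncomputable def starAlgEquiv :
    letI := commCStarAlgebra B
    LinfAbs B ≃⋆ₐ[ℂ] C(Stone B, ℂ) :=
  letI := commCStarAlgebra B
  { equivContinuous B with
    map_add' := fun _ _ => (equivContinuous B).apply_symm_apply _
    map_mul' := fun _ _ => (equivContinuous B).apply_symm_apply _
    map_smul' := fun _ _ => (equivContinuous B).apply_symm_apply _
    map_star' := fun _ => (equivContinuous B).apply_symm_apply _ }

theorem starOrderedRing :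
    letI := commCStarAlgebra B
    letI := partialOrder B
    StarOrderedRing (LinfAbs B) := by
  let := commCStarAlgebra B
  let := partialOrder B
  let e := starAlgEquiv B
  refine StarOrderedRing.of_le_iff fun f g => ?_
  have h1 : f ≤ g ↔ 0 ≤ e g - e f := (sub_nonneg (a := e g) (b := e f)).symm
  rw [h1, CStarAlgebra.nonneg_iff_eq_star_mul_self]
  constructor
  · rintro ⟨c, hc⟩
    refine ⟨e.symm c, EquivLike.injective e ?_⟩
    rw [map_add, map_mul, map_star, e.apply_symm_apply, ← hc, add_sub_cancel]
  · rintro ⟨c, rfl⟩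
    exact ⟨e c, by rw [map_add, map_mul, map_star, add_sub_cancel_left]⟩

theorem sigmaComplete :
    letI := commCStarAlgebra B
    letI := partialOrder B
    IsMonotoneSigmaComplete (LinfAbs B) := by
  let := commCStarAlgebra B
  let := partialOrder B
  intro a hsa hmono hb
  obtain ⟨s, hs⟩ := Stone.isMonotoneSigmaComplete B (fun n => starAlgEquiv B (a n))
    (fun n => (hsa n).map (starAlgEquiv B)) hmono hb
  refine ⟨(equivContinuous B).symm s, ?_, fun t ht => ?_⟩
  · rintro _ ⟨n, rfl⟩
    show equivContinuous B (a n) ≤ equivContinuous B ((equivContinuous B).symm s)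
    rw [Equiv.apply_symm_apply]
    exact hs.1 ⟨n, rfl⟩
  · show equivContinuous B ((equivContinuous B).symm s) ≤ equivContinuous B t
    rw [Equiv.apply_symm_apply]
    refine hs.2 ?_
    rintro _ ⟨n, rfl⟩
    exact ht ⟨n, rfl⟩

/-- The monotone σ-complete C⋆-algebra structure of the abstract `L^∞`: the operations transported
from `C(Stone B, ℂ)` are those given by pairings. -/
noncomputable def cstarStructure : CStarStructure B (hasPairings B) :=
  letI := commCStarAlgebra B
  letI := partialOrder B
  haveI := starOrderedRing B
  have hsymm : ∀ f, ofContinuous (equivContinuous B f) = f := (equivContinuous B).symm_apply_apply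
  { zero_def := (const_eq_ofContinuous 0).symm
    one_def := (const_eq_ofContinuous 1).symm
    add_def := fun f g => by
      conv_rhs => rw [← hsymm f, ← hsymm g, binop_ofContinuous]
      rfl
    mul_def := fun f g => by
      conv_rhs => rw [← hsymm f, ← hsymm g, binop_ofContinuous]
      rfl
    smul_def := fun c f => by
      conv_rhs => rw [← hsymm f, unop_ofContinuous]
      rfl
    star_def := fun f => by
      conv_rhs => rw [← hsymm f, unop_ofContinuous]
      rfl
    norm_def := fun f => by
      conv_rhs => rw [← hsymm f, ← norm_ofContinuous]
      rfl
    sigmaComplete := sigmaComplete B }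

end

/-- The abstract `L^∞` of `B` is isomorphic to `C(Stone B, ℂ)`. -/
noncomputable def isoContinuous (B : SigmaBool.{u}) :
    (cstarStructure B).toCommSigmaCStar ≅ ⟨C(Stone B, ℂ), Stone.isMonotoneSigmaComplete B⟩ :=
  CommSigmaCStar.isoOfStarAlgEquiv (A := (cstarStructure B).toCommSigmaCStar)
    (B := ⟨C(Stone B, ℂ), Stone.isMonotoneSigmaComplete B⟩) (starAlgEquiv B)

theorem exists_map_hom {A B : SigmaBool.{u}} (φ : SigmaHom A B) :
    ∃ ψ : (cstarStructure A).toCommSigmaCStar ⟶ (cstarStructure B).toCommSigmaCStar,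
      ∀ f : LinfAbs A, ψ.toStarAlgHom f = LinfAbs.map φ f := by
  refine ⟨(isoContinuous A).hom ≫ (cStoneFunctor Stone.isMonotoneSigmaComplete
    fun _ _ => Stone.isSigmaNormal_pullback).map φ ≫ (isoContinuous B).inv, fun f => ?_⟩
  obtain ⟨g, rfl⟩ := ofContinuous_bijective.2 f
  rw [map_ofContinuous]
  show ofContinuous (Stone.pullback φ.toBoundedLatticeHom
    (equivContinuous A ((equivContinuous A).symm g))) = _
  rw [Equiv.apply_symm_apply]

/-- Sending a continuous function to its law is natural. -/
noncomputable def natIso :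
    linfAbsFunctor.{u} hasPairings cstarStructure (fun _ _ => exists_map_hom) ≅
      cStoneFunctor Stone.isMonotoneSigmaComplete fun _ _ => Stone.isSigmaNormal_pullback :=
  NatIso.ofComponents isoContinuous fun {A B} φ => by
    refine CommSigmaCStar.Hom.ext (StarAlgHom.ext fun f => ?_)
    have hf : ∀ f : LinfAbs A, equivContinuous B (LinfAbs.map φ f) =
        Stone.pullback φ.toBoundedLatticeHom (equivContinuous A f) := by
      intro f
      obtain ⟨g, rfl⟩ := ofContinuous_bijective.2 f
      rw [map_ofContinuous, ← equivContinuous_symm_apply, ← equivContinuous_symm_apply,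
        Equiv.apply_symm_apply, Equiv.apply_symm_apply]
    exact (congrArg (equivContinuous B) ((exists_map_hom φ).choose_spec f)).trans (hf f)

end LinfAbs

/-! ### Projections of `C(Stone B, ℂ)` -/

/-- An isomorphism of posets between Boolean σ-algebras is an isomorphism of Boolean
σ-algebras. -/
def SigmaBool.isoOfOrderIso {A B : SigmaBool.{u}} (e : A ≃o B) : A ≅ B :=
  let hom {A B : SigmaBool.{u}} (e : A ≃o B) : SigmaHom A B :=
    { toFun := e
      map_sup' := e.map_sup
      map_inf' := e.map_inf
      map_top' := e.map_top
      map_bot' := e.map_bot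
      map_isLUB' := fun p s hs => by
        have h := e.isLUB_image'.2 hs
        rwa [← range_comp] at h }
  { hom := hom e
    inv := hom e.symm
    hom_inv_id := SigmaHom.ext e.symm_apply_apply
    inv_hom_id := SigmaHom.ext e.apply_symm_apply }

namespace Stone

variable {B : Type u} [BooleanAlgebra B]

/-- The projection of `C(Stone B, ℂ)` given by the indicator function of a basic clopen set. -/
noncomputable def indicatorProj (b : B) : Projections C(Stone B, ℂ) :=
  ⟨⟨(basic b).indicator 1,
    (continuous_const (y := (1 : ℂ))).indicator fun x hx => by
      rw [IsClopen.frontier_eq ⟨isClosed_basic b, isOpen_basic b⟩] at hx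
      exact hx.elim⟩, by
    refine ⟨ContinuousMap.ext fun x => ?_, ContinuousMap.ext fun x => ?_⟩ <;>
    · by_cases hx : x ∈ basic b <;> simp [hx]⟩

theorem indicatorProj_apply (b : B) (x : Stone B) :
    (indicatorProj b : C(Stone B, ℂ)) x = (basic b).indicator 1 x := rfl

theorem indicatorProj_le_iff {a b : B} : indicatorProj a ≤ indicatorProj b ↔ a ≤ b := by
  rw [← basic_subset_basic (a := a) (b := b)]
  constructor
  · intro h x hx
    by_contra hxb
    have h1 : (indicatorProj a : C(Stone B, ℂ)) x ≤ (indicatorProj b : C(Stone B, ℂ)) x := h x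
    rw [indicatorProj_apply, indicatorProj_apply, indicator_of_mem hx,
      indicator_of_notMem hxb] at h1
    exact one_ne_zero (h1.antisymm zero_le_one)
  · exact fun h x => indicator_le_indicator_of_subset h (fun _ => zero_le_one) x

theorem apply_eq_zero_or_one {X : Type v} [TopologicalSpace X] [CompactSpace X]
    (p : Projections C(X, ℂ)) (x : X) : p.1 x = 0 ∨ p.1 x = 1 :=
  IsIdempotentElem.iff_eq_zero_or_one.1 (DFunLike.congr_fun p.2.isIdempotentElem x)

theorem indicatorProj_surjective :
    Function.Surjective (indicatorProj : B → Projections C(Stone B, ℂ)) := by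
  intro p
  have hS : IsClopen (p.1 ⁻¹' {1}) := by
    refine ⟨isClosed_singleton.preimage p.1.continuous, ?_⟩
    have : p.1 ⁻¹' {1} = (p.1 ⁻¹' {0})ᶜ := by
      ext x
      rcases apply_eq_zero_or_one p x with h | h <;> simp [h]
    rw [this]
    exact (isClosed_singleton.preimage p.1.continuous).isOpen_compl
  obtain ⟨b, hb⟩ := exists_eq_basic hS
  refine ⟨b, Subtype.ext (ContinuousMap.ext fun x => ?_)⟩
  rw [indicatorProj_apply, ← hb]
  rcases apply_eq_zero_or_one p x with h | h <;> simp [h]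

/-- The elements of `B` correspond to the projections of `C(Stone B, ℂ)`. -/
noncomputable def projectionsOrderIso (B : Type u) [BooleanAlgebra B] :
    B ≃o Projections C(Stone B, ℂ) :=
  RelIso.ofSurjective (OrderEmbedding.ofMapLEIff indicatorProj fun _ _ => indicatorProj_le_iff)
    indicatorProj_surjective

end Stone

/-! ### Characters and ultrafilters of projections -/

open WeakDual

/-- In a monotone σ-complete `C(X, ℂ)` the projections separate points: the supremum of the
functions `min (n b) 1` for `b ≥ 0` is a projection that is `1` where `b > 0`, and `0` wherever
some continuous function vanishes that dominates all `min (n b) 1`. -/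
theorem exists_projection_separating {X : Type u} [TopologicalSpace X] [CompactSpace X] [T2Space X]
    (hX : IsMonotoneSigmaComplete C(X, ℂ)) {x y : X} (hxy : x ≠ y) :
    ∃ p : Projections C(X, ℂ), p.1 x = 1 ∧ p.1 y = 0 := by
  obtain ⟨f, hfy, hfx, hf⟩ := exists_continuous_zero_one_of_isClosed
    (isClosed_singleton (x := y)) (isClosed_singleton (x := x))
    (disjoint_singleton.2 hxy.symm)
  replace hfy : f y = 0 := hfy rfl
  replace hfx : f x = 1 := hfx rfl
  -- The function `2 * f` dominates all `min (n b) 1`, since `2 * f > 1` where `b > 0`.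
  let b : X → ℝ := fun z => max (2 * f z - 1) 0
  have hb0 : ∀ z, 0 ≤ b z := fun z => le_max_right _ _
  let r : ℕ → X → ℝ := fun n z => min (n * b z) 1
  have hr0 : ∀ n z, 0 ≤ r n z := fun n z =>
    le_min (mul_nonneg n.cast_nonneg (hb0 z)) zero_le_one
  have hr1 : ∀ n z, r n z ≤ 1 := fun n z => min_le_right _ _
  let a : ℕ → C(X, ℂ) := fun n => ⟨fun z => (r n z : ℂ), by fun_prop⟩
  have ha0 : ∀ n z, 0 ≤ a n z := fun n z => Complex.zero_le_real.2 (hr0 n z)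
  obtain ⟨s, hs⟩ := hX a (fun n => ContinuousMap.ext fun z => Complex.conj_ofReal _)
    (fun m n hmn z => Complex.real_le_real.2 <| min_le_min_right _ <|
      mul_le_mul_of_nonneg_right (Nat.cast_le.2 hmn) (hb0 z))
    ⟨1, fun n => (ContinuousMap.norm_le _ zero_le_one).2 fun z => by
      show ‖(r n z : ℂ)‖ ≤ 1
      rw [Complex.norm_real, Real.norm_of_nonneg (hr0 n z)]
      exact hr1 n z⟩
  have hle : ∀ n z, a n z ≤ s z := fun n z => hs.1 ⟨n, rfl⟩ z
  have hs0 : 0 ≤ s := fun z => (ha0 0 z).trans (hle 0 z)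
  have hs1 : s ≤ 1 := hs.2 <| by
    rintro _ ⟨n, rfl⟩ z
    exact Complex.real_le_real.2 (hr1 n z)
  have hone : ∀ z, 0 < b z → s z = 1 := by
    intro z hz
    obtain ⟨n, hn⟩ := exists_nat_ge (b z)⁻¹
    refine (hs1 z).antisymm (le_trans (le_of_eq ?_) (hle n z))
    have : r n z = 1 := min_eq_right ((inv_le_iff_one_le_mul₀ hz).1 hn)
    show (1 : ℂ) = (r n z : ℂ)
    rw [this, Complex.ofReal_one]
  have hzero : ∀ n z, b z = 0 → a n z = 0 := by
    intro n z hz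
    have : r n z = 0 := by simp [r, hz]
    show (r n z : ℂ) = 0
    rw [this, Complex.ofReal_zero]
  have hsq : s ≤ s * s := hs.2 <| by
    rintro _ ⟨n, rfl⟩ z
    show a n z ≤ s z * s z
    rcases (hb0 z).eq_or_lt with hz | hz
    · rw [hzero n z hz.symm]
      exact mul_nonneg (hs0 z) (hs0 z)
    · rw [hone z hz, mul_one, ← hone z hz]
      exact hle n z
  have hsq' : s * s ≤ s := fun z => mul_le_of_le_one_right (hs0 z) (hs1 z)
  have hk : s ≤ ⟨fun z => ((2 * f z : ℝ) : ℂ), by fun_prop⟩ := hs.2 <| by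
    rintro _ ⟨n, rfl⟩ z
    refine Complex.real_le_real.2 ?_
    show r n z ≤ 2 * f z
    rcases (hb0 z).eq_or_lt with hz | hz
    · have : r n z = 0 := by simp [r, ← hz]
      rw [this]
      exact mul_nonneg zero_le_two (hf z).1
    · have h1 : 0 < 2 * f z - 1 := by
        by_contra! h
        exact hz.ne' (max_eq_right h)
      linarith [hr1 n z]
  refine ⟨⟨s, hsq'.antisymm hsq, hs0.isSelfAdjoint⟩, hone x ?_, le_antisymm ?_ (hs0 y)⟩
  · simp only [b, hfx]
    norm_num
  · refine (hk y).trans (le_of_eq ?_)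
    show ((2 * f y : ℝ) : ℂ) = 0
    simp [hfy]

theorem IsMonotoneSigmaComplete.of_starAlgEquiv {A : Type u} {B : Type v}
    [CommCStarAlgebra A] [PartialOrder A] [StarOrderedRing A]
    [CommCStarAlgebra B] [PartialOrder B] [StarOrderedRing B]
    (hA : IsMonotoneSigmaComplete A) (e : A ≃⋆ₐ[ℂ] B) : IsMonotoneSigmaComplete B := by
  rintro a hsa hmono ⟨M, hM⟩
  obtain ⟨s, hs⟩ := hA (fun n => e.symm (a n)) (fun n => (hsa n).map e.symm)
    (fun i j hij => OrderHomClass.mono e.symm (hmono hij))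
    ⟨M, fun n => (NonUnitalStarAlgHom.norm_apply_le e.symm _).trans (hM n)⟩
  refine ⟨e s, ?_⟩
  have h := (OrderIsoClass.toOrderIso e).isLUB_image'.2 hs
  rw [← range_comp] at h
  have he : ((OrderIsoClass.toOrderIso e : A ≃o B) ∘ fun n => e.symm (a n)) = a :=
    funext fun n => e.apply_symm_apply (a n)
  rw [he] at h
  exact h

namespace CommSigmaCStar

variable (A : CommSigmaCStar.{u})

theorem character_eq_zero_or_one (χ : characterSpace ℂ A) (p : Projections A) :
    χ p.1 = 0 ∨ χ p.1 = 1 :=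
  IsIdempotentElem.iff_eq_zero_or_one.1 (by
    have := congrArg χ p.2.isIdempotentElem.eq
    rwa [map_mul] at this)

/-- The ultrafilter of the projections on which a character takes the value `1`. -/
def characterUltrafilter (χ : characterSpace ℂ A) : Stone (Projections A) where
  carrier := {p | χ p.1 = 1}
  top_mem := map_one χ
  inf_mem p q hp hq := by
    show χ (p.1 * q.1) = 1
    rw [map_mul, show χ p.1 = 1 from hp, show χ q.1 = 1 from hq, mul_one]
  mem_of_le p q hpq hp := by
    have h := congrArg χ (Projections.le_iff.1 hpq)
    rwa [map_mul, show χ p.1 = 1 from hp, one_mul] at h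
  compl_mem_iff p := by
    show χ (1 - p.1) = 1 ↔ χ p.1 ≠ 1
    rw [map_sub, map_one]
    rcases character_eq_zero_or_one A χ p with h | h <;> simp [h]

theorem continuous_characterUltrafilter : Continuous (characterUltrafilter A) := by
  refine continuous_generateFrom_iff.2 ?_
  rintro _ ⟨p, rfl⟩
  have : characterUltrafilter A ⁻¹' Stone.basic p = (gelfandTransform ℂ A p.1 ⁻¹' {0})ᶜ := by
    ext χ
    show χ p.1 = 1 ↔ ¬ χ p.1 = 0
    rcases character_eq_zero_or_one A χ p with h | h <;> simp [h]
  rw [this]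
  exact (isClosed_singleton.preimage (gelfandTransform ℂ A p.1).continuous).isOpen_compl

theorem characterUltrafilter_injective : Function.Injective (characterUltrafilter A) := by
  intro χ ψ h
  by_contra hne
  obtain ⟨p, hp, hp'⟩ := exists_projection_separating
    (A.sigmaComplete.of_starAlgEquiv (gelfandStarTransform A)) hne
  let q : Projections A := ⟨(gelfandStarTransform A).symm p.1,
    p.2.map (gelfandStarTransform A).symm⟩
  have hq : ∀ ω : characterSpace ℂ A, ω q.1 = p.1 ω := fun ω =>
    DFunLike.congr_fun ((gelfandStarTransform A).apply_symm_apply p.1) ω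
  have h1 : q ∈ (characterUltrafilter A χ).carrier := (hq χ).trans hp
  rw [h] at h1
  have h2 : ψ q.1 = 1 := h1
  rw [hq, hp'] at h2
  exact zero_ne_one h2

theorem characterUltrafilter_surjective : Function.Surjective (characterUltrafilter A) := by
  have hd : DenseRange (characterUltrafilter A) := by
    refine Stone.isTopologicalBasis_basic.dense_iff.2 ?_
    rintro _ ⟨p, rfl⟩ ⟨x, hx⟩
    have hp : gelfandStarTransform A p.1 ≠ 0 := by
      rw [map_ne_zero_iff _ (EquivLike.injective _)]
      intro h0
      obtain rfl : p = ⊥ := Subtype.ext h0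
      rw [Stone.basic_bot] at hx
      exact hx
    obtain ⟨χ, hχ⟩ := DFunLike.ne_iff.1 hp
    exact ⟨characterUltrafilter A χ, (character_eq_zero_or_one A χ p).resolve_left hχ, χ, rfl⟩
  rw [← range_eq_univ, ← hd.closure_range,
    (isCompact_range (continuous_characterUltrafilter A)).isClosed.closure_eq]

/-- Characters of a commutative monotone σ-complete C⋆-algebra correspond to ultrafilters of
projections. -/
noncomputable def characterHomeomorph : characterSpace ℂ A ≃ₜ Stone (Projections A) :=
  (continuous_characterUltrafilter A).homeoOfEquivCompactToT2
    (f := Equiv.ofBijective _ ⟨characterUltrafilter_injective A, characterUltrafilter_surjective A⟩)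

/-- `C(Stone (Proj A))` is isomorphic to `A`, by Gelfand duality. -/
noncomputable def starAlgEquiv : C(Stone (Projections A), ℂ) ≃⋆ₐ[ℂ] A :=
  ((characterHomeomorph A).compStarAlgEquiv' ℂ ℂ).trans (gelfandStarTransform A).symm

theorem character_starAlgEquiv (χ : characterSpace ℂ A) (g : C(Stone (Projections A), ℂ)) :
    χ (starAlgEquiv A g) = g (characterUltrafilter A χ) :=
  DFunLike.congr_fun ((gelfandStarTransform A).apply_symm_apply
    ((characterHomeomorph A).compStarAlgEquiv' ℂ ℂ g)) χ

end CommSigmaCStar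

/-! ### The equivalences -/

namespace CommSigmaCStar

/-- The functor `C(Stone(-))`. -/
noncomputable abbrev cStone : SigmaBool.{u} ⥤ CommSigmaCStar.{u} :=
  cStoneFunctor Stone.isMonotoneSigmaComplete fun _ _ => Stone.isSigmaNormal_pullback

/-- Every Boolean σ-algebra is naturally isomorphic to the projections of `C(Stone B, ℂ)`. -/
noncomputable def unitIso : 𝟭 SigmaBool.{u} ≅ cStone ⋙ projFunctor :=
  NatIso.ofComponents
    (fun B => SigmaBool.isoOfOrderIso (B := (cStone ⋙ projFunctor).obj B)
      (Stone.projectionsOrderIso B))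
    fun _ => rfl

/-- Every commutative monotone σ-complete C⋆-algebra `A` is naturally isomorphic to
`C(Stone (Proj A))`. -/
noncomputable def counitIso : projFunctor ⋙ cStone ≅ 𝟭 CommSigmaCStar.{u} :=
  NatIso.ofComponents
    (fun A => isoOfStarAlgEquiv (A := (projFunctor ⋙ cStone).obj A) (starAlgEquiv A))
    fun {A B} φ => by
      refine Hom.ext (StarAlgHom.ext fun g => (gelfandStarTransform B).injective ?_)
      refine ContinuousMap.ext fun χ => ?_
      have h1 := character_starAlgEquiv B χ
        (Stone.pullback (projFunctor.map φ).toBoundedLatticeHom g)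
      have h2 := character_starAlgEquiv A (CharacterSpace.compContinuousMap φ.toStarAlgHom χ) g
      exact h1.trans h2.symm

/-- The equivalence given by `C(Stone(-))` and `Proj`. -/
noncomputable def cStoneEquivalence : SigmaBool.{u} ≌ CommSigmaCStar.{u} :=
  CategoryTheory.Equivalence.mk cStone projFunctor unitIso counitIso

end CommSigmaCStar

end

theorem corollary4p7 :
    ∃ (hC : ∀ B : SigmaBool.{u}, IsMonotoneSigmaComplete C(Stone B, ℂ))
      (hC' : ∀ (A B : SigmaBool.{u}) (φ : SigmaHom A B),
        IsSigmaNormal (Stone.pullback φ.toBoundedLatticeHom))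
      (hpair : ∀ B : SigmaBool.{u}, LinfAbs.HasPairings B)
      (S : ∀ B : SigmaBool.{u}, LinfAbs.CStarStructure B (hpair B))
      (hL : ∀ (A B : SigmaBool.{u}) (φ : SigmaHom A B),
        ∃ ψ : (S A).toCommSigmaCStar ⟶ (S B).toCommSigmaCStar,
          ∀ f : LinfAbs A, ψ.toStarAlgHom f = LinfAbs.map φ f),
      (∃ e : SigmaBool.{u} ≌ CommSigmaCStar.{u},
        e.functor = cStoneFunctor hC hC' ∧ e.inverse = projFunctor) ∧
      (∃ e : SigmaBool.{u} ≌ CommSigmaCStar.{u},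
        e.functor = linfAbsFunctor hpair S hL ∧ e.inverse = projFunctor) ∧
      Nonempty (linfAbsFunctor hpair S hL ≅ cStoneFunctor hC hC') :=
  ⟨Stone.isMonotoneSigmaComplete, fun _ _ => Stone.isSigmaNormal_pullback, LinfAbs.hasPairings,
    LinfAbs.cstarStructure, fun _ _ => LinfAbs.exists_map_hom,
    ⟨CommSigmaCStar.cStoneEquivalence, rfl, rfl⟩,
    ⟨CommSigmaCStar.cStoneEquivalence.changeFunctor LinfAbs.natIso.symm, rfl, rfl⟩,
    ⟨LinfAbs.natIso⟩⟩
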